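/- A $\mathbb{C}[[\hbar]]$-module $W$ is topologically free if $W=W_0[[\hbar]]$ for some $\mathbb{C}$-subspace $W_0$. Then $\mathcal{E}_\hbar(W)$ denotes the set of $a(x)=\sum_{n\in\mathbb{Z}}a(n)x^n\in(\mathrm{End}\,W)[[x,x^{-1}]]$ (where $\mathrm{End}\,W$ consists of the $\mathbb{C}[[\hbar]]$-linear endomorphisms) such that $a(x)w\in W_\hbar((x))$ for all $w\in W$, that is, $a(-n)w\to0$ $\hbar$-adically as $n\to\infty$. An $\hbar$-adic nonlocal vertex algebra is a topologically free $\mathbb{C}[[\hbar]]$-module $V$ with a $\mathbb{C}[[\hbar]]$-linear map $Y(\cdot,x):V\to(\mathrm{End}\,V)[[x,x^{-1}]]$ with values in $\mathcal{E}_\hbar(V)$ and a vector $\mathbf 1\in V$ such that $Y(\mathbf 1,x)=1_V$, such that $Y(v,x)\mathbf 1\in V[[x]]$ has constant term $v$ for every $v\in V$, and such that for all $u,v,w\in V$ and every $n\ge1$ there is $l\in\mathbb{N}$ with $$(x_0+x_2)^lY(u,x_0+x_2)Y(v,x_2)w\equiv(x_2+x_0)^lY(Y(u,x_0)v,x_2)w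 \pmod{\hbar^nV[[x_0^{\pm1},x_2^{\pm1}]]},$$ where powers of $x_0+x_2$ are expanded in nonnegative powers of $x_2$. A $V$-module is a topologically free $\mathbb{C}[[\hbar]]$-module $W$ with a $\mathbb{C}[[\hbar]]$-linear map $Y_W(\cdot,x):V\to(\mathrm{End}\,W)[[x,x^{-1}]]$ with values in $\mathcal{E}_\hbar(W)$ such that $Y_W(\mathbf 1,x)=1_W$ and such that for all $u,v\in V$, $w\in W$ and every $n\ge1$ there is $l\in\mathbb{N}$ with $$(x_0+x_2)^lY_W(u,x_0+x_2)Y_W(v,x_2)w\equiv(x_2+x_0)^lY_W(Y(u,x_0)v,x_2)w \pmod{\hbar^nW[[x_0^{\pm1},x_2^{\pm1}]]}.$$ It is faithful if $v\mapsto Y_W(v,x)$ is injective. For $a(x),b(x)\in\mathcal{E}_\hbar(W)$, the order-$2$ Serre relation for $(a(z_1),a(z_2),b(w))$ is $$\sum_{\sigma\in S_2}\Big(a(z_{\sigma(1)})a(z_{\sigma(2)})b(w)-2a(z_{\sigma(1)})b(w)a(z_{\sigma(2)})+b(w)a(z_{\sigma(1)})a(z_{\sigma(2)})\Big)=0.$$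 **Proposition.** Let $V$ be an $\hbar$-adic nonlocal vertex algebra and let $a,b\in V$. If $$(z-w-2\hbar)Y(a,z)Y(a,w)=(z-w+2\hbar)Y(a,w)Y(a,z),$$ $$(z-w+\hbar)Y(a,z)Y(b,w)=(z-w-\hbar)Y(b,w)Y(a,z),$$ and if the order-$2$ Serre relation for $(Y(a,z_1),Y(a,z_2),Y(b,w))$ holds, then for any $V$-module $(W,Y_W)$, $$(z-w-2\hbar)Y_W(a,z)Y_W(a,w)=(z-w+2\hbar)Y_W(a,w)Y_W(a,z),$$ $$(z-w+\hbar)Y_W(a,z)Y_W(b,w)=(z-w-\hbar)Y_W(b,w)Y_W(a,z),$$ and the order-$2$ Serre relation for $(Y_W(a,z_1),Y_W(a,z_2),Y_W(b,w))$ holds. Conversely, if $(W,Y_W)$ is a faithful $V$-module on which the last three relations hold, then the first three relations hold on $V$. -/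

import Mathlib

namespace HAdic

/-- The base ring `ℂ[[ħ]]`. -/
abbrev CH : Type := PowerSeries ℂ

/-- The formal variable `ħ` of `ℂ[[ħ]]`. -/
noncomputable def hbar : CH := PowerSeries.X

section Topology

variable {W : Type*} [AddCommGroup W] [Module CH W]

/-- The submodule `ħ ^ n W` of `W`. -/
noncomputable def hPow (W : Type*) [AddCommGroup W] [Module CH W] (n : ℕ) : Submodule CH W :=
  LinearMap.range (LinearMap.lsmul CH W (hbar ^ n))

theorem mem_hPow {n : ℕ} {w : W} : w ∈ hPow W n ↔ ∃ w' : W, hbar ^ n • w' = w := by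
  simp [hPow, LinearMap.mem_range]

/-- `w` is the limit of `∑ ħ ^ k s k` in the `ħ`-adic topology. -/
def IsHSum (s : ℕ → W) (w : W) : Prop :=
  ∀ n : ℕ, w - ∑ k ∈ Finset.range n, hbar ^ k • s k ∈ hPow W n

/-- `W` is topologically free: `W = W₀[[ħ]]` for some `ℂ`-subspace `W₀` of `W`. That is, every
series `∑ ħ ^ k s k` with coefficients in `W₀` has exactly one `ħ`-adic limit, and every vector
is the limit of exactly one such series. -/
def IsTopologicallyFree (W : Type*) [AddCommGroup W] [Module CH W] : Prop :=
  ∃ W₀ : AddSubgroup W, (∀ c : ℂ, ∀ w ∈ W₀, PowerSeries.C c • w ∈ W₀) ∧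
    (∀ s : ℕ → W, (∀ k, s k ∈ W₀) → ∃! w : W, IsHSum s w) ∧
    (∀ w : W, ∃! s : ℕ → W, (∀ k, s k ∈ W₀) ∧ IsHSum s w)

end Topology

/-- Elements `a(x) = ∑ₖ a k xᵏ` of `(End W)[[x, x⁻¹]]`, given by their coefficients. So the usual
mode `v_n` of `Y(v, x) = ∑ₙ v_n x ^ (-n-1)` is the coefficient with index `-n-1`. -/
abbrev OpSeries (W : Type*) [AddCommGroup W] [Module CH W] : Type _ := ℤ → Module.End CH W

section Fields

variable {V W : Type*} [AddCommGroup V] [Module CH V] [AddCommGroup W] [Module CH W]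

/-- `ψ(x) ∈ M_ħ((x))`: the coefficients of `x ^ (-n)` tend to `0` in the `ħ`-adic topology as `n`
tends to infinity. -/
def IsHLaurent (ψ : ℤ → W) : Prop :=
  ∀ r : ℕ, ∃ k : ℕ, ∀ n : ℕ, k ≤ n → ψ (-(n : ℤ)) ∈ hPow W r

/-- `a(x) ∈ 𝓔_ħ(W) = Hom(W, W_ħ((x)))`. -/
def IsHField (a : OpSeries W) : Prop := ∀ w : W, IsHLaurent fun k => a k w

/-- The identity operator, as a series in `(End W)[[x, x⁻¹]]`. -/
noncomputable def oneField (W : Type*) [AddCommGroup W] [Module CH W] : OpSeries W :=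
  fun k => if k = 0 then 1 else 0

/-- The `j`-th contribution to the coefficient of `x₀ᵖ x₂^q` in
`(x₀ + x₂) ^ l Y_W(u, x₀ + x₂) Y_W(v, x₂) w`, where powers of `x₀ + x₂` are expanded in nonnegative
powers of `x₂`: the contribution of `(p + j choose j) x₀ᵖ x₂ʲ` from `(x₀ + x₂) ^ (p + j)`. The
coefficient is the `ħ`-adically convergent sum of these over all `j`. -/
noncomputable def assocProductTerm (YW : V →ₗ[CH] OpSeries W) (u v : V) (w : W) (l : ℕ) (p q : ℤ)
    (j : ℕ) : W :=
  Ring.choose (p + j) j • YW u (p + j - l) (YW v (q - j) w)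

/-- The coefficient of `x₀ᵖ x₂^q` in `(x₂ + x₀) ^ l Y_W(Y(u, x₀) v, x₂) w`. -/
noncomputable def assocIterateCoeff (Y : V →ₗ[CH] OpSeries V) (YW : V →ₗ[CH] OpSeries W) (u v : V)
    (w : W) (l : ℕ) (p q : ℤ) : W :=
  ∑ i ∈ Finset.range (l + 1), l.choose i • YW (Y u (p - i) v) (q - (l - i)) w

/-- The `ħ`-adic weak associativity: for all `u v w` and `n` there is an `l` with
`(x₀ + x₂) ^ l Y_W(u, x₀ + x₂) Y_W(v, x₂) w ≡ (x₂ + x₀) ^ l Y_W(Y(u, x₀) v, x₂) w` modulo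
`ħ ^ n W[[x₀^±1, x₂^±1]]`. Congruence of a coefficient on the left, a convergent series, is
congruence of all late partial sums (which are all congruent to one another modulo `ħ ^ n`). -/
def WeakAssociativity (Y : V →ₗ[CH] OpSeries V) (YW : V →ₗ[CH] OpSeries W) : Prop :=
  ∀ (u v : V) (w : W) (n : ℕ), 0 < n → ∃ l : ℕ, ∀ p q : ℤ, ∃ J : ℕ, ∀ N : ℕ, J ≤ N →
    ∑ j ∈ Finset.range N, assocProductTerm YW u v w l p q j - assocIterateCoeff Y YW u v w l p q
      ∈ hPow W n

end Fields

/-- An `ħ`-adic nonlocal vertex algebra structure on `V`. -/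
structure NonlocalVertexAlgebra (V : Type*) [AddCommGroup V] [Module CH V] where
  topFree : IsTopologicallyFree V
  /-- the vertex operator map `v ↦ Y(v, x)` -/
  Y : V →ₗ[CH] OpSeries V
  /-- the vacuum vector -/
  vac : V
  isHLaurent : ∀ u v : V, IsHLaurent fun k => Y u k v
  Y_vac : Y vac = oneField V
  Y_apply_vac_neg : ∀ (v : V) (k : ℤ), k < 0 → Y v k vac = 0
  Y_apply_vac_zero : ∀ v : V, Y v 0 vac = v
  weakAssoc : WeakAssociativity Y Y

/-- The structure of a module for the `ħ`-adic nonlocal vertex algebra `A` on `W`. -/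
structure VModule {V : Type*} [AddCommGroup V] [Module CH V] (A : NonlocalVertexAlgebra V)
    (W : Type*) [AddCommGroup W] [Module CH W] where
  topFree : IsTopologicallyFree W
  /-- the vertex operator map `v ↦ Y_W(v, x)` -/
  YW : V →ₗ[CH] OpSeries W
  isHField : ∀ v : V, IsHField (YW v)
  YW_vac : YW A.vac = oneField W
  weakAssoc : WeakAssociativity A.Y YW

/-- A module is faithful if `v ↦ Y_W(v, x)` is injective. -/
def VModule.Faithful {V : Type*} [AddCommGroup V] [Module CH V] {A : NonlocalVertexAlgebra V}
    {W : Type*} [AddCommGroup W] [Module CH W] (M : VModule A W) : Prop :=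
  Function.Injective M.YW

section Relations

variable {W : Type*} [AddCommGroup W] [Module CH W]

/-- `(z - w + c) F(z, w)` for a scalar `c` and `F(z, w) = ∑ F i j zⁱ wʲ`. -/
noncomputable def mulLinear (c : CH) (F : ℤ → ℤ → Module.End CH W) : ℤ → ℤ → Module.End CH W :=
  fun i j => F (i - 1) j - F i (j - 1) + c • F i j

/-- The exchange relation `(z - w + μ) a(z) b(w) = (z - w + ν) b(w) a(z)`. -/
def ExchangeRelation (μ ν : CH) (a b : OpSeries W) : Prop :=
  mulLinear μ (fun i j => a i * b j) = mulLinear ν (fun i j => b j * a i)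

/-- The order-2 Serre relation for `(a(z₁), a(z₂), b(w))`: the sum over `σ ∈ S₂` of
`a(z_σ(1)) a(z_σ(2)) b(w) - 2 a(z_σ(1)) b(w) a(z_σ(2)) + b(w) a(z_σ(1)) a(z_σ(2))` vanishes.
Here `k` lists the exponents of `z₁`, `z₂`, and `j` is the exponent of `w`. -/
def SerreRelation (a b : OpSeries W) : Prop :=
  ∀ (k : Fin 2 → ℤ) (j : ℤ),
    ∑ σ : Equiv.Perm (Fin 2),
      (a (k (σ 0)) * a (k (σ 1)) * b j - 2 * (a (k (σ 0)) * b j * a (k (σ 1)))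
        + b j * a (k (σ 0)) * a (k (σ 1))) = 0

end Relations

end HAdic

/-! Modulo `ħ ^ n` the fields become genuine Laurent series, and topologically free modules are
`ħ`-adically separated, so each relation can be checked on every quotient `W / ħ ^ n W`. There weak
associativity is an exact identity: substituting `z + x` for `z` in `z ^ l Y(u, z) Y(v, x) w` gives
`(x + z) ^ l Y(Y(u, z) v, x) w`. Iterating it compares `Y(u₁, z₁ + x) Y(u₂, z₂ + x) Y(v, x) w` with
`Y(Y(u₁, z₁) Y(u₂, z₂) v, x) w`, up to powers of `x + zᵢ`. The factors `z₁ - z₂ + c` are invariant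
under the common shift, so a relation between products on the module corresponds to the same
relation on the algebra inside `Y_W(-, x)`.

From algebra to module, take `v = 1` and the coefficient of `x ^ 0` (`coeff_zero`). Conversely,
cancel the powers of `x + zᵢ`, which is legitimate for series bounded below in `zᵢ`
(`eq_zero_of_addMul_pow_eq_zero`), and use faithfulness.

The difficulty is that iteration needs one exponent `l` for all the vectors `Y(u₂, z₂) v` produces.
By `assocWith_of_bounded` an exponent works as soon as the shifted series has bounded poles in `z`.
For `v = 1` the coefficients of `Y(u₂, z) 1` are divided derivatives of `u₂`, which keep the
exponent (`assocWith_creation`). For general `v` the exchange relation on the module gives the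
bound, because its constants are divisible by `ħ` and hence nilpotent modulo `ħ ^ n`
(`assocWith_of_exchange`). The cubic Serre words use this second mechanism in both directions. -/

namespace HAdic

/-! ### The substitution `z ↦ z + x` and multiplication by `x + z`. -/

section Shift

variable {M : Type*} [AddCommGroup M]

theorem succ_mul_choose_succ (r : ℤ) (k : ℕ) :
    ((k : ℤ) + 1) * Ring.choose r (k + 1) = (r - k) * Ring.choose r k := by
  have h := Ring.choose_smul_choose r (Nat.le_succ k)
  simp only [Nat.succ_eq_add_one, Nat.choose_succ_self_right, nsmul_eq_mul, Nat.add_sub_cancel_left,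
    Ring.choose_one_right] at h
  push_cast at h
  linarith [mul_comm (Ring.choose r k) (r - k)]

/-- The series `g(z, x)` is the expansion of `f(z + x, x)` in nonnegative powers of `x`, all the
sums being eventually constant. -/
def IsShift (f g : ℤ → ℤ → M) : Prop :=
  ∀ p q : ℤ, ∃ J : ℕ, ∀ N : ℕ, J ≤ N →
    ∑ j ∈ Finset.range N, Ring.choose (p + j) j • f (p + j) (q - j) = g p q

namespace IsShift

variable {f g f' g' : ℤ → ℤ → M}

theorem unique (h : IsShift f g) (h' : IsShift f g') : g = g' := by
  ext p q
  obtain ⟨J, hJ⟩ := h p q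
  obtain ⟨J', hJ'⟩ := h' p q
  rw [← hJ (max J J') (le_max_left _ _), ← hJ' (max J J') (le_max_right _ _)]

theorem add (h : IsShift f g) (h' : IsShift f' g') : IsShift (f + f') (g + g') := by
  intro p q
  obtain ⟨J, hJ⟩ := h p q
  obtain ⟨J', hJ'⟩ := h' p q
  refine ⟨max J J', fun N hN => ?_⟩
  simp only [Pi.add_apply, smul_add, Finset.sum_add_distrib]
  rw [hJ N (le_trans (le_max_left _ _) hN), hJ' N (le_trans (le_max_right _ _) hN)]

theorem map {M' : Type*} [AddCommGroup M'] (φ : M →+ M') (h : IsShift f g) :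
    IsShift (fun p q => φ (f p q)) fun p q => φ (g p q) := by
  intro p q
  obtain ⟨J, hJ⟩ := h p q
  refine ⟨J, fun N hN => ?_⟩
  dsimp only
  rw [← hJ N hN, map_sum]
  simp only [map_zsmul]

theorem neg (h : IsShift f g) : IsShift (-f) (-g) :=
  h.map (-AddMonoidHom.id M)

theorem sub (h : IsShift f g) (h' : IsShift f' g') : IsShift (f - f') (g - g') := by
  rw [sub_eq_add_neg, sub_eq_add_neg]
  exact h.add h'.neg

theorem zero : IsShift (0 : ℤ → ℤ → M) 0 := fun _ _ => ⟨0, fun _ _ => by simp⟩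

theorem sum {ι : Type*} (s : Finset ι) {f g : ι → ℤ → ℤ → M} (h : ∀ i ∈ s, IsShift (f i) (g i)) :
    IsShift (∑ i ∈ s, f i) (∑ i ∈ s, g i) := by
  classical
  induction s using Finset.induction_on with
  | empty => simpa using zero
  | insert a s ha ih =>
    rw [Finset.sum_insert ha, Finset.sum_insert ha]
    exact (h a (Finset.mem_insert_self _ _)).add (ih fun i hi => h i (Finset.mem_insert_of_mem hi))

theorem translate (h : IsShift f g) (d : ℤ) :
    IsShift (fun p q => f p (q - d)) fun p q => g p (q - d) := by
  intro p q
  obtain ⟨J, hJ⟩ := h p (q - d)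
  refine ⟨J, fun N hN => ?_⟩
  dsimp only
  rw [← hJ N hN]
  refine Finset.sum_congr rfl fun j _ => ?_
  rw [sub_right_comm]

/-- A lower bound on the powers of `x` makes the cutoff explicit and independent of `p`, so iterated
substitutions become sums over one finite square. -/
theorem sum_eq {B : ℤ} (h : IsShift f g) (hB : ∀ p, ∀ q < B, f p q = 0) (p q : ℤ) {N : ℕ}
    (hN : q - B < N) :
    ∑ j ∈ Finset.range N, Ring.choose (p + j) j • f (p + j) (q - j) = g p q := by
  obtain ⟨J, hJ⟩ := h p q
  rw [← hJ (max J N) (le_max_left _ _)]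
  refine Finset.sum_subset (Finset.range_mono (le_max_right _ _)) fun j _ hj => ?_
  rw [hB _ _ (by simp at hj; omega), smul_zero]

theorem eq_zero_of_lt {B : ℤ} (h : IsShift f g) (hB : ∀ p, ∀ q < B, f p q = 0) (p q : ℤ)
    (hq : q < B) : g p q = 0 := by
  rw [← h.sum_eq hB p q (N := 0) (by simpa using hq), Finset.sum_range_zero]

theorem exists_of_bounded {B : ℤ} (hB : ∀ p, ∀ q < B, f p q = 0) : ∃ g, IsShift f g := by
  refine ⟨fun p q => ∑ j ∈ Finset.range (q - B + 1).toNat,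
    Ring.choose (p + j) j • f (p + j) (q - j), fun p q => ⟨(q - B + 1).toNat, fun N hN => ?_⟩⟩
  refine (Finset.sum_subset (Finset.range_mono hN) fun j _ hj => ?_).symm
  rw [hB _ _ (by simp at hj; omega), smul_zero]

/-- Chain rule: if `g(z, x) = f(z + x, x)`, then the partial derivative of `f` in its second slot
becomes `(∂_x - ∂_z) g`. -/
theorem deriv (h : IsShift f g) :
    IsShift (fun p q => (q + 1) • f p (q + 1))
      fun p q => (q + 1) • g p (q + 1) - (p + 1) • g (p + 1) q := by
  intro p q
  obtain ⟨J, hJ⟩ := h p (q + 1)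
  obtain ⟨J', hJ'⟩ := h (p + 1) q
  refine ⟨max J J' + 1, fun N hN => ?_⟩
  obtain ⟨N, rfl⟩ : ∃ N', N = N' + 1 := ⟨N - 1, by omega⟩
  dsimp only
  -- The term `j` of the `∂_z` sum pairs with the term `j + 1` of the others, leaving only `j = 0`.
  rw [← hJ (N + 1) (by omega), ← hJ' N (by omega), Finset.sum_range_succ',
    Finset.sum_range_succ' _ N, smul_add, add_sub_right_comm, Finset.smul_sum, Finset.smul_sum,
    ← Finset.sum_sub_distrib]
  congr 1
  · refine Finset.sum_congr rfl fun j _ => ?_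
    have h1 : p + ((j + 1 : ℕ) : ℤ) = p + 1 + j := by push_cast; ring
    have h2 : q - ((j + 1 : ℕ) : ℤ) + 1 = q - j := by push_cast; ring
    have h3 : q + 1 - ((j + 1 : ℕ) : ℤ) = q - j := by push_cast; ring
    rw [h1, h2, h3, smul_smul, smul_smul, smul_smul, ← sub_smul]
    congr 1
    have := succ_mul_choose_succ (p + 1 + j) j
    linear_combination (-1 : ℤ) * this
  · simp

end IsShift

variable [Module CH M]

/-- Multiplication of `f(z, x) = ∑ f p q zᵖ x^q` by `x + z`. -/
def addMul (M : Type*) [AddCommGroup M] [Module CH M] : Module.End CH (ℤ → ℤ → M) where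
  toFun f p q := f p (q - 1) + f (p - 1) q
  map_add' f g := by ext p q; simp only [Pi.add_apply]; abel
  map_smul' c f := by ext p q; simp

theorem addMul_apply (f : ℤ → ℤ → M) (p q : ℤ) :
    addMul M f p q = f p (q - 1) + f (p - 1) q := rfl

theorem addMul_pow_apply (l : ℕ) (f : ℤ → ℤ → M) (p q : ℤ) :
    (addMul M ^ l) f p q = ∑ i ∈ Finset.range (l + 1), l.choose i • f (p - i) (q - (l - i)) := by
  let Z : Module.End CH (ℤ → ℤ → M) :=
    { toFun := fun f p q => f (p - 1) q, map_add' := fun _ _ => rfl, map_smul' := fun _ _ => rfl }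
  let X : Module.End CH (ℤ → ℤ → M) :=
    { toFun := fun f p q => f p (q - 1), map_add' := fun _ _ => rfl, map_smul' := fun _ _ => rfl }
  have hZ : ∀ (i : ℕ) (f : ℤ → ℤ → M) p q, (Z ^ i) f p q = f (p - i) q := by
    intro i
    induction i with
    | zero => intro f p q; simp
    | succ i ih =>
      intro f p q
      rw [pow_succ, Module.End.mul_apply, ih]
      change f (p - i - 1) q = _
      push_cast; congr 1; ring
  have hX : ∀ (i : ℕ) (f : ℤ → ℤ → M) p q, (X ^ i) f p q = f p (q - i) := by
    intro i
    induction i with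
    | zero => intro f p q; simp
    | succ i ih =>
      intro f p q
      rw [pow_succ, Module.End.mul_apply, ih]
      change f p (q - i - 1) = _
      push_cast; congr 1; ring
  have h : addMul M = Z + X := by
    ext f p q
    exact add_comm _ _
  have hc : Commute Z X := rfl
  rw [h, hc.add_pow, LinearMap.sum_apply, Finset.sum_apply, Finset.sum_apply]
  refine Finset.sum_congr rfl fun i hi => ?_
  have hi' : i ≤ l := Nat.lt_succ_iff.mp (Finset.mem_range.mp hi)
  rw [← nsmul_eq_mul', LinearMap.smul_apply, Pi.smul_apply, Pi.smul_apply, Module.End.mul_apply,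
    hZ, hX, Nat.cast_sub hi']

/-- For one factor, the equation `f p q = -f (p - 1) (q + 1)` propagates zeros upwards from the
bound in `z`. The bound is essential: the series with coefficients `(-1) ^ p` on an antidiagonal are
killed by `x + z`. -/
theorem eq_zero_of_addMul_pow_eq_zero (l : ℕ) {f : ℤ → ℤ → M} (hf : ∃ k : ℤ, ∀ p < k, ∀ q, f p q = 0)
    (h : (addMul M ^ l) f = 0) : f = 0 := by
  obtain ⟨k, hk⟩ := hf
  have key : ∀ g : ℤ → ℤ → M, (∀ p < k, ∀ q, g p q = 0) → addMul M g = 0 → g = 0 := by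
    intro g hg h
    have : ∀ n : ℕ, ∀ p < k + n, ∀ q, g p q = 0 := by
      intro n
      induction n with
      | zero => simpa using hg
      | succ n ih =>
        intro p hp q
        have := congrFun (congrFun h p) (q + 1)
        rw [addMul_apply, ih (p - 1) (by push_cast at hp; omega)] at this
        simpa using this
    ext p q
    exact this (p - k + 1).toNat p (by omega) q
  induction l with
  | zero => simpa using h
  | succ l ih =>
    apply ih
    rw [pow_succ', Module.End.mul_apply] at h
    refine key _ (fun p hp q => ?_) h
    rw [addMul_pow_apply]
    refine Finset.sum_eq_zero fun i _ => ?_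
    rw [hk _ (by omega), smul_zero]

theorem addMul_pow_injOn (l : ℕ) {f g : ℤ → ℤ → M} (hf : ∃ k : ℤ, ∀ p < k, ∀ q, f p q = 0)
    (hg : ∃ k : ℤ, ∀ p < k, ∀ q, g p q = 0) (h : (addMul M ^ l) f = (addMul M ^ l) g) : f = g := by
  obtain ⟨k, hk⟩ := hf
  obtain ⟨k', hk'⟩ := hg
  refine sub_eq_zero.mp (eq_zero_of_addMul_pow_eq_zero l ⟨min k k', fun p hp q => ?_⟩ ?_)
  · simp [hk p (lt_of_lt_of_le hp (min_le_left _ _)), hk' p (lt_of_lt_of_le hp (min_le_right _ _))]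
  · rw [map_sub, h, sub_self]

theorem addMul_pow_eq_zero_of_lt (l : ℕ) {f : ℤ → ℤ → M} {k : ℤ} (hk : ∀ p < k, ∀ q, f p q = 0) :
    ∀ p < k, ∀ q, (addMul M ^ l) f p q = 0 := by
  intro p hp q
  rw [addMul_pow_apply]
  refine Finset.sum_eq_zero fun i _ => ?_
  rw [hk _ (by omega), smul_zero]

namespace IsShift

variable {f g f' g' : ℤ → ℤ → M}

theorem smul (c : CH) (h : IsShift f g) : IsShift (c • f) (c • g) :=
  h.map (LinearMap.lsmul CH M c).toAddMonoidHom

/-- Multiplication by `z` turns into multiplication by `z + x`; on coefficients this is Pascal's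
rule. -/
theorem mulFirst (h : IsShift f g) : IsShift (fun p q => f (p - 1) q) (addMul M g) := by
  intro p q
  obtain ⟨J, hJ⟩ := h p (q - 1)
  obtain ⟨J', hJ'⟩ := h (p - 1) q
  refine ⟨max (J + 1) J', fun N hN => ?_⟩
  obtain ⟨N, rfl⟩ : ∃ N', N = N' + 1 := ⟨N - 1, by omega⟩
  dsimp only
  rw [addMul_apply, ← hJ N (by omega), ← hJ' (N + 1) (by omega), Finset.sum_range_succ',
    Finset.sum_range_succ' _ N, ← add_assoc, ← Finset.sum_add_distrib]
  congr 1
  · refine Finset.sum_congr rfl fun j _ => ?_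
    have h1 : p + ((j + 1 : ℕ) : ℤ) = (p + j) + 1 := by push_cast; ring
    have h2 : p - 1 + ((j + 1 : ℕ) : ℤ) = p + j := by push_cast; ring
    have h3 : q - ((j + 1 : ℕ) : ℤ) = q - 1 - j := by push_cast; ring
    rw [h1, h2, h3, Ring.choose_succ_succ, add_smul, add_sub_cancel_right]
  · simp

theorem mulFirst_pow (h : IsShift f g) (l : ℕ) :
    IsShift (fun p q => f (p - l) q) ((addMul M ^ l) g) := by
  induction l with
  | zero => simpa using h
  | succ l ih =>
    rw [pow_succ', Module.End.mul_apply]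
    convert ih.mulFirst using 3
    push_cast; ring_nf

end IsShift

end Shift


/-! ### Simultaneous substitutions in two and three variables. -/

section Shift

variable {M : Type*} [AddCommGroup M]

/-- `g(z₁, z₂, x)` is the expansion of `f(z₁ + x, z₂ + x, x)`. -/
def IsShift₂ (f g : ℤ → ℤ → ℤ → M) : Prop :=
  ∃ e : ℤ → ℤ → ℤ → M, (∀ p, IsShift (f p) (e p)) ∧
    ∀ r, IsShift (fun p q => e p r q) fun p q => g p r q

/-- `g(z₁, z₂, z₃, x)` is the expansion of `f(z₁ + x, z₂ + x, z₃ + x, x)`. -/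
def IsShift₃ (f g : ℤ → ℤ → ℤ → ℤ → M) : Prop :=
  ∃ e : ℤ → ℤ → ℤ → ℤ → M, (∀ p, IsShift₂ (f p) (e p)) ∧
    ∀ r s, IsShift (fun p q => e p r s q) fun p q => g p r s q

namespace IsShift₂

variable {f g f' g' : ℤ → ℤ → ℤ → M}

theorem add (h : IsShift₂ f g) (h' : IsShift₂ f' g') : IsShift₂ (f + f') (g + g') := by
  obtain ⟨e, he, hg⟩ := h
  obtain ⟨e', he', hg'⟩ := h'
  exact ⟨e + e', fun p => (he p).add (he' p), fun r => (hg r).add (hg' r)⟩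

theorem sub (h : IsShift₂ f g) (h' : IsShift₂ f' g') : IsShift₂ (f - f') (g - g') := by
  obtain ⟨e, he, hg⟩ := h
  obtain ⟨e', he', hg'⟩ := h'
  exact ⟨e - e', fun p => (he p).sub (he' p), fun r => (hg r).sub (hg' r)⟩

theorem unique (h : IsShift₂ f g) (h' : IsShift₂ f g') : g = g' := by
  obtain ⟨e, he, hg⟩ := h
  obtain ⟨e', he', hg'⟩ := h'
  obtain rfl : e = e' := funext fun p => (he p).unique (he' p)
  ext p r q
  exact congrFun (congrFun ((hg r).unique (hg' r)) p) q

theorem sum_eq {B : ℤ} (h : IsShift₂ f g) (hB : ∀ p r, ∀ q < B, f p r q = 0) (p r q : ℤ) {N : ℕ}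
    (hN : q - B < N) :
    ∑ j ∈ Finset.range N, ∑ k ∈ Finset.range N, Ring.choose (p + j) j • Ring.choose (r + k) k •
      f (p + j) (r + k) (q - j - k) = g p r q := by
  obtain ⟨e, he, hg⟩ := h
  rw [← (hg r).sum_eq (fun p q hq => (he p).eq_zero_of_lt (hB p) r q hq) p q hN]
  refine Finset.sum_congr rfl fun j _ => ?_
  rw [← (he _).sum_eq (hB _) r (q - j) (N := N) (by omega), Finset.smul_sum]

theorem exists_of_bounded {B : ℤ} (hB : ∀ p r, ∀ q < B, f p r q = 0) : ∃ g, IsShift₂ f g := by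
  choose e he using fun p => IsShift.exists_of_bounded (hB p)
  choose g hg using fun r => IsShift.exists_of_bounded (f := fun p q => e p r q)
    fun p q hq => (he p).eq_zero_of_lt (hB p) r q hq
  exact ⟨fun p r q => g r p q, e, he, hg⟩

/-- Boundedness in `x` makes both iterated substitutions finite double sums over the same square, so
their order is immaterial. -/
theorem swap {B : ℤ} (h : IsShift₂ f g) (hB : ∀ p r, ∀ q < B, f p r q = 0) :
    IsShift₂ (fun p r q => f r p q) fun p r q => g r p q := by
  have hB' : ∀ p r, ∀ q < B, (fun p r q => f r p q) p r q = 0 := fun p r q hq => hB r p q hq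
  obtain ⟨k, hk⟩ := exists_of_bounded hB'
  suffices (fun p r q => g r p q) = k by rwa [this]
  ext p r q
  rw [← hk.sum_eq hB' p r q (N := (q - B + 1).toNat) (by omega),
    ← h.sum_eq hB r p q (N := (q - B + 1).toNat) (by omega), Finset.sum_comm]
  refine Finset.sum_congr rfl fun j _ => Finset.sum_congr rfl fun k _ => ?_
  rw [smul_comm, sub_right_comm]

end IsShift₂

namespace IsShift₃

variable {f g f' g' : ℤ → ℤ → ℤ → ℤ → M}

theorem add (h : IsShift₃ f g) (h' : IsShift₃ f' g') : IsShift₃ (f + f') (g + g') := by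
  obtain ⟨e, he, hg⟩ := h
  obtain ⟨e', he', hg'⟩ := h'
  exact ⟨e + e', fun p => (he p).add (he' p), fun r s => (hg r s).add (hg' r s)⟩

theorem sub (h : IsShift₃ f g) (h' : IsShift₃ f' g') : IsShift₃ (f - f') (g - g') := by
  obtain ⟨e, he, hg⟩ := h
  obtain ⟨e', he', hg'⟩ := h'
  exact ⟨e - e', fun p => (he p).sub (he' p), fun r s => (hg r s).sub (hg' r s)⟩

theorem unique (h : IsShift₃ f g) (h' : IsShift₃ f g') : g = g' := by
  obtain ⟨e, he, hg⟩ := h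
  obtain ⟨e', he', hg'⟩ := h'
  obtain rfl : e = e' := funext fun p => (he p).unique (he' p)
  ext p r s q
  exact congrFun (congrFun ((hg r s).unique (hg' r s)) p) q

theorem zero : IsShift₃ (0 : ℤ → ℤ → ℤ → ℤ → M) 0 :=
  ⟨0, fun _ => ⟨0, fun _ => IsShift.zero, fun _ => IsShift.zero⟩, fun _ _ => IsShift.zero⟩

theorem swap_right {B : ℤ} (h : IsShift₃ f g) (hB : ∀ p r s, ∀ q < B, f p r s q = 0) :
    IsShift₃ (fun p r s q => f p s r q) fun p r s q => g p s r q := by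
  obtain ⟨e, he, hg⟩ := h
  exact ⟨fun p r s q => e p s r q, fun p => (he p).swap (hB p), fun r s => hg s r⟩

/-- The third variable is substituted first and then frozen as a parameter, which leaves a swap of
two variables. -/
theorem swap_left {B : ℤ} (h : IsShift₃ f g) (hB : ∀ p r s, ∀ q < B, f p r s q = 0) :
    IsShift₃ (fun p r s q => f r p s q) fun p r s q => g r p s q := by
  obtain ⟨e, he, hg⟩ := h
  choose d hd he using he
  have hd0 : ∀ p r s, ∀ q < B, d p r s q = 0 := fun p r s q hq =>
    (hd p r).eq_zero_of_lt (hB p r) s q hq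
  have h2 : ∀ s, IsShift₂ (fun p r q => d p r s q) fun p r q => g p r s q := fun s =>
    ⟨fun p r q => e p r s q, fun p => he p s, fun r => hg r s⟩
  choose c hc hg' using fun s => (h2 s).swap fun p r q hq => hd0 p r s q hq
  exact ⟨fun p r s q => c s p r q, fun p => ⟨fun r s q => d r p s q, fun r => hd r p,
    fun s => hc s p⟩, fun r s => hg' s r⟩

end IsShift₃

variable [Module CH M]

theorem IsShift₂.smul {f g : ℤ → ℤ → ℤ → M} (c : CH) (h : IsShift₂ f g) :
    IsShift₂ (c • f) (c • g) := by
  obtain ⟨e, he, hg⟩ := h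
  exact ⟨c • e, fun p => (he p).smul c, fun r => (hg r).smul c⟩

/-- Multiplication of `f(z₁, z₂, x)` by `z₁ - z₂ + c`. -/
noncomputable def mulLinear₂ (c : CH) (f : ℤ → ℤ → ℤ → M) : ℤ → ℤ → ℤ → M :=
  fun p r q => f (p - 1) r q - f p (r - 1) q + c • f p r q

/-- Translation invariance of `z₁ - z₂`: the two extra multiplications by `x` cancel. -/
theorem IsShift₂.mulLinear₂ {f g : ℤ → ℤ → ℤ → M} (c : CH) (h : IsShift₂ f g) :
    IsShift₂ (mulLinear₂ c f) (mulLinear₂ c g) := by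
  have h1 : IsShift₂ (fun p r q => f (p - 1) r q) fun p r q => g p r (q - 1) + g (p - 1) r q := by
    obtain ⟨e, he, hg⟩ := h
    exact ⟨fun p r q => e (p - 1) r q, fun p => he (p - 1), fun r => (hg r).mulFirst⟩
  have h2 : IsShift₂ (fun p r q => f p (r - 1) q) fun p r q => g p r (q - 1) + g p (r - 1) q := by
    obtain ⟨e, he, hg⟩ := h
    exact ⟨fun p r q => e p r (q - 1) + e p (r - 1) q, fun p => (he p).mulFirst,
      fun r => ((hg r).translate 1).add (hg (r - 1))⟩
  convert (h1.sub h2).add (h.smul c) using 1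
  · rfl
  · ext p r q
    simp [HAdic.mulLinear₂]

theorem addMul_pow_map (l : ℕ) (φ : Module.End CH M) (f : ℤ → ℤ → M) (p q : ℤ) :
    (addMul M ^ l) (fun p q => φ (f p q)) p q = φ ((addMul M ^ l) f p q) := by
  rw [addMul_pow_apply, addMul_pow_apply, map_sum]
  simp only [map_nsmul]

theorem IsShift.addMul_pow_param (l : ℕ) {f g : ℤ → ℤ → ℤ → M}
    (h : ∀ r, IsShift (fun p q => f p r q) fun p q => g p r q) (r : ℤ) :
    IsShift (fun p q => (addMul M ^ l) (f p) r q) fun p q => (addMul M ^ l) (g p) r q := by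
  convert IsShift.sum (Finset.range (l + 1))
    (f := fun i p q => l.choose i • f p (r - i) (q - (l - i)))
    (g := fun i p q => l.choose i • g p (r - i) (q - (l - i))) (fun i _ => ?_) using 1
  · ext p q
    simp [addMul_pow_apply]
  · ext p q
    simp [addMul_pow_apply]
  · have := ((h (r - i)).translate (l - i)).map
      (smulAddHom ℕ M (l.choose i))
    exact this

theorem addMul_pow_comm (l : ℕ) (f : ℤ → ℤ → ℤ → M) (p r q : ℤ) :
    (addMul M ^ l) (fun p q => (addMul M ^ l) (f p) r q) p q =
      (addMul M ^ l) (fun r q => (addMul M ^ l) (fun p q => f p r q) p q) r q := by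
  simp only [addMul_pow_apply, Finset.smul_sum]
  rw [Finset.sum_comm]
  refine Finset.sum_congr rfl fun i _ => Finset.sum_congr rfl fun j _ => ?_
  rw [smul_comm, sub_right_comm]

/-- The bound may vary with `r`, but only the finitely many values `r - i` with `i ≤ l` enter. -/
theorem addMul_pow_bounded_param (l : ℕ) {f : ℤ → ℤ → ℤ → M}
    (h : ∀ r, ∃ k : ℤ, ∀ p < k, ∀ q, f p r q = 0) (r : ℤ) :
    ∃ k : ℤ, ∀ p < k, ∀ q, (addMul M ^ l) (f p) r q = 0 := by
  choose k hk using h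
  obtain ⟨K, hK⟩ := ((Finset.range (l + 1)).image fun i : ℕ => k (r - i)).bddBelow
  refine ⟨K, fun p hp q => ?_⟩
  rw [addMul_pow_apply]
  refine Finset.sum_eq_zero fun i hi => ?_
  rw [hk _ _ (lt_of_lt_of_le hp (hK (Finset.mem_coe.mpr (Finset.mem_image_of_mem _ hi)))),
    smul_zero]

theorem eq_zero_of_addMul_pow_eq_zero₂ (l : ℕ) {f : ℤ → ℤ → ℤ → M}
    (h1 : ∀ r, ∃ k : ℤ, ∀ p < k, ∀ q, f p r q = 0) (h2 : ∀ p, ∃ k : ℤ, ∀ r < k, ∀ q, f p r q = 0)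
    (h : ∀ p r q, (addMul M ^ l) (fun p q => (addMul M ^ l) (f p) r q) p q = 0) : f = 0 := by
  funext p
  refine eq_zero_of_addMul_pow_eq_zero l (h2 p) ?_
  ext r q
  have := eq_zero_of_addMul_pow_eq_zero l (f := fun p q => (addMul M ^ l) (f p) r q)
    (addMul_pow_bounded_param l h1 r) (by ext p q; exact h p r q)
  exact congrFun (congrFun this p) q

theorem eq_zero_of_addMul_pow_eq_zero₃ (l : ℕ) {f : ℤ → ℤ → ℤ → ℤ → M}
    (h1 : ∀ r s, ∃ k : ℤ, ∀ p < k, ∀ q, f p r s q = 0)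
    (h2 : ∀ p s, ∃ k : ℤ, ∀ r < k, ∀ q, f p r s q = 0)
    (h3 : ∀ p r, ∃ k : ℤ, ∀ s < k, ∀ q, f p r s q = 0)
    (h : ∀ p r s q, (addMul M ^ l) (fun p q =>
      (addMul M ^ l) (fun r q => (addMul M ^ l) (f p r) s q) r q) p q = 0) : f = 0 := by
  funext p r
  refine eq_zero_of_addMul_pow_eq_zero l (h3 p r) ?_
  ext s q
  have := eq_zero_of_addMul_pow_eq_zero₂ l (f := fun p r q => (addMul M ^ l) (f p r) s q)
    (fun r => addMul_pow_bounded_param l (f := fun p => f p r) (h1 r) s)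
    (fun p => addMul_pow_bounded_param l (h2 p) s) (fun p r q => h p r s q)
  exact congrFun (congrFun (congrFun this p) r) q

end Shift


/-! ### Modules modulo `ħ ^ n` and uniform associativity exponents. -/

section Truncated

variable {V M : Type*} [AddCommGroup V] [Module CH V] [AddCommGroup M] [Module CH M]

/-- Weak associativity for `u`, `v`, `w` with the exponent `l`, on a module over which all series
are Laurent series. -/
def AssocWith (Y : V →ₗ[CH] OpSeries V) (YM : V →ₗ[CH] OpSeries M) (l : ℕ) (u v : V) (w : M) :
    Prop :=
  IsShift (fun p q => YM u (p - l) (YM v q w)) ((addMul M ^ l) fun p q => YM (Y u p v) q w)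

/-- The reduction modulo `ħ ^ n` of a module for the `ħ`-adic nonlocal vertex algebra `A`. -/
structure IsTruncatedModule (A : NonlocalVertexAlgebra V) (n : ℕ) (YM : V →ₗ[CH] OpSeries M) :
    Prop where
  hbar_pow_smul : ∀ w : M, hbar ^ n • w = 0
  bounded : ∀ (u : V) (w : M), ∃ k : ℤ, ∀ p < k, YM u p w = 0
  vac : YM A.vac = oneField M
  assoc : ∀ (u v : V) (w : M), ∃ l : ℕ, AssocWith A.Y YM l u v w

theorem AssocWith.mono {Y : V →ₗ[CH] OpSeries V} {YM : V →ₗ[CH] OpSeries M} {l l' : ℕ} {u v : V}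
    {w : M} (h : AssocWith Y YM l u v w) (hl : l ≤ l') : AssocWith Y YM l' u v w := by
  obtain ⟨d, rfl⟩ := Nat.exists_eq_add_of_le' hl
  have := h.mulFirst_pow d
  rw [← Module.End.mul_apply, ← pow_add] at this
  unfold AssocWith
  convert this using 5
  push_cast; ring

namespace IsTruncatedModule

variable {A : NonlocalVertexAlgebra V} {n : ℕ} {YM : V →ₗ[CH] OpSeries M}

theorem eq_zero_of_mem_hPow (h : IsTruncatedModule A n YM) {v : V} (hv : v ∈ hPow V n) :
    YM v = 0 := by
  obtain ⟨v', rfl⟩ := mem_hPow.mp hv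
  ext p w
  rw [map_smul, Pi.smul_apply, LinearMap.smul_apply, h.hbar_pow_smul]
  rfl

theorem iterate_bounded (A : NonlocalVertexAlgebra V) (n : ℕ) (u v : V) :
    ∃ k : ℤ, ∀ p < k, A.Y u p v ∈ hPow V n := by
  obtain ⟨k, hk⟩ := A.isHLaurent u v n
  refine ⟨1 - k, fun p hp => ?_⟩
  have := hk (-p).toNat (by omega)
  rwa [Int.toNat_of_nonneg (by omega), neg_neg] at this

/-- Some exponent `l'` always works. Multiplying by the complementary powers gives two expressions
for the exponent `l + l'`, and `(x + z) ^ l'` cancels since both sides are bounded in `z`. Control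
of exponents is thereby reduced to bounding poles. -/
theorem assocWith_of_bounded (h : IsTruncatedModule A n YM) {l : ℕ} {u v : V} {w : M}
    {g : ℤ → ℤ → M} (hg : IsShift (fun p q => YM u (p - l) (YM v q w)) g)
    (hb : ∃ k : ℤ, ∀ p < k, ∀ q, g p q = 0) : AssocWith A.Y YM l u v w := by
  obtain ⟨l', hl'⟩ := h.assoc u v w
  have h1 := hg.mulFirst_pow l'
  have h2 := hl'.mulFirst_pow l
  have h3 : (addMul M ^ l') g =
      (addMul M ^ l') ((addMul M ^ l) fun p q => YM (A.Y u p v) q w) := by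
    refine h1.unique ?_
    rw [← Module.End.mul_apply, ← pow_add, add_comm, pow_add, Module.End.mul_apply]
    convert h2 using 5
    ring
  obtain ⟨k, hk⟩ := iterate_bounded A n u v
  have h4 := addMul_pow_injOn l' hb ⟨k, addMul_pow_eq_zero_of_lt l fun p hp q => by
    rw [h.eq_zero_of_mem_hPow (hk p hp)]; rfl⟩ h3
  rw [h4] at hg
  exact hg

/-- The expansion of `(z + x) ^ l Y(u, z + x) w`, written with `v = 1` in `Y(u, z) Y(v, x) w`. -/
theorem vac_isShift (h : IsTruncatedModule A n YM) (l : ℕ) (u : V) (w : M) :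
    IsShift (fun p q => YM u (p - l) (YM A.vac q w)) fun p q =>
      if 0 ≤ q then Ring.choose (p + q) q.toNat • YM u (p + q - l) w else 0 := by
  intro p q
  refine ⟨q.toNat + 1, fun N hN => ?_⟩
  simp only [h.vac, oneField]
  split_ifs with hq
  · rw [Finset.sum_eq_single q.toNat]
    · rw [Int.toNat_of_nonneg hq]; simp
    · intro j _ hj
      rw [if_neg (by omega)]; simp
    · intro hj
      simp at hj; omega
  · refine Finset.sum_eq_zero fun j _ => ?_
    rw [if_neg (by omega)]; simp

/-- If `z ^ l Y(u, z) w` has no pole, its expansion at `z + x` has no pole in `z` either. -/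
theorem vac_assocWith (h : IsTruncatedModule A n YM) {l : ℕ} {u : V} {w : M}
    (hl : ∀ p < 0, YM u (p - l) w = 0) : AssocWith A.Y YM l u A.vac w := by
  refine h.assocWith_of_bounded (h.vac_isShift l u w) ⟨0, fun p hp q => ?_⟩
  split_ifs with hq
  · by_cases hpq : p + q < 0
    · rw [hl _ hpq, smul_zero]
    -- Here `0 ≤ p + q < q`, so the binomial coefficient is zero.
    · obtain ⟨m, hm⟩ := Int.eq_ofNat_of_zero_le (not_lt.mp hpq)
      have hm' : p + q = (m : ℤ) := hm
      rw [hm', Ring.choose_natCast, Nat.choose_eq_zero_of_lt (by omega), Nat.cast_zero, zero_smul]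
  · rfl

/-- The operator `∂_z - ∂_x` on series in `z` and `x`. -/
def derivSub (M : Type*) [AddCommGroup M] [Module CH M] : Module.End CH (ℤ → ℤ → M) where
  toFun f p q := (p + 1) • f (p + 1) q - (q + 1) • f p (q + 1)
  map_add' f g := by ext p q; simp only [Pi.add_apply, smul_add]; abel
  map_smul' c f := by ext p q; simp [smul_sub, smul_comm c]

/-- The derivation `∂_z - ∂_x` annihilates `z + x`. -/
theorem derivSub_comm : Commute (derivSub M) (addMul M) := by
  ext f p q
  simp only [Module.End.mul_apply, derivSub, addMul, LinearMap.coe_mk, AddHom.coe_mk,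
    sub_add_cancel, add_sub_cancel_right]
  module

/-- The series `(x + z) ^ l Y(Y(v, z) 1, x) w` is a function of `z + x` alone, so `∂_z - ∂_x` kills
it, and the power of `x + z` can then be cancelled. This expresses each coefficient of `Y(v, z) 1`
as a multiple of the derivative of the previous one. -/
theorem succ_smul_vac (h : IsTruncatedModule A n YM) (v : V) (w : M) (p q : ℤ) :
    (p + 1) • YM (A.Y v (p + 1) A.vac) q w = (q + 1) • YM (A.Y v p A.vac) (q + 1) w := by
  obtain ⟨k, hk⟩ := h.bounded v w
  have hl := h.vac_assocWith (u := v) (w := w) (l := (-k).toNat) fun p hp => hk _ (by omega)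
  have hE := hl.unique (h.vac_isShift _ v w)
  set H : ℤ → ℤ → M := fun p q => YM (A.Y v p A.vac) q w with hH
  have h0 : (addMul M ^ (-k).toNat) (derivSub M H) = 0 := by
    rw [← Module.End.mul_apply, ← (derivSub_comm.pow_right _).eq, Module.End.mul_apply, hE]
    ext p q
    simp only [derivSub, LinearMap.coe_mk, AddHom.coe_mk, Pi.zero_apply]
    rcases lt_trichotomy q (-1) with hq | rfl | hq
    · rw [if_neg (by omega), if_neg (by omega)]; simp
    -- At the boundary `q = -1` one term is cut off and the factor `q + 1` kills the other.
    · simp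
    · obtain ⟨m, rfl⟩ := Int.eq_ofNat_of_zero_le (show 0 ≤ q by omega)
      rw [if_pos (by omega), if_pos (by omega)]
      have h1 : ((m : ℤ) + 1).toNat = m + 1 := by omega
      have h2 := succ_mul_choose_succ (p + 1 + m) m
      rw [sub_eq_zero, smul_smul, smul_smul, h1]
      have h3 : p + ((m : ℤ) + 1) = p + 1 + m := by ring
      rw [h3, Int.toNat_natCast, h2]
      congr 2
      ring
  have hz := eq_zero_of_addMul_pow_eq_zero _ ?_ h0
  · have := congrFun (congrFun hz p) q
    exact sub_eq_zero.mp this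
  · obtain ⟨k, hk⟩ := iterate_bounded A n v A.vac
    have hk' : ∀ p < k, ∀ q, H p q = 0 := fun p hp q => by
      rw [hH]; dsimp only; rw [h.eq_zero_of_mem_hPow (hk p hp)]; rfl
    refine ⟨k - 1, fun p hp q => ?_⟩
    simp only [derivSub, LinearMap.coe_mk, AddHom.coe_mk]
    rw [hk' _ (by omega), hk' _ (by omega)]; simp

theorem eq_zero_of_intCast_smul {c : ℤ} (hc : c ≠ 0) {w : M} (h : c • w = 0) : w = 0 := by
  have h1 : (PowerSeries.C ((c : ℂ)⁻¹) : CH) * (c : CH) = 1 := by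
    have : (c : CH) = PowerSeries.C (c : ℂ) := by simp
    rw [this, ← map_mul, inv_mul_cancel₀ (by exact_mod_cast hc), map_one]
  rw [← one_smul CH w, ← h1, mul_smul, Int.cast_smul_eq_zsmul, h, smul_zero]

/-- Differentiation in `x` before the shift leaves `z ^ l` untouched. By the chain rule it lowers
the bound in `z` by one, which is harmless: `assocWith_of_bounded` asks only for some bound, so `l`
does not grow. -/
theorem assocWith_of_deriv (h : IsTruncatedModule A n YM) {l : ℕ} {u v v' : V} {w : M} {c : ℤ}
    (hc : c ≠ 0) (hd : ∀ q, c • YM v' q w = (q + 1) • YM v (q + 1) w)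
    (hl : AssocWith A.Y YM l u v w) : AssocWith A.Y YM l u v' w := by
  obtain ⟨B, hB⟩ := h.bounded v' w
  obtain ⟨g, hg⟩ := IsShift.exists_of_bounded (f := fun p q => YM u (p - l) (YM v' q w)) (B := B)
    fun p q hq => by rw [hB q hq, map_zero]
  refine h.assocWith_of_bounded hg ?_
  have h1 : IsShift (fun p q => (q + 1) • YM u (p - l) (YM v (q + 1) w)) fun p q => c • g p q := by
    have : IsShift (fun p q => c • YM u (p - l) (YM v' q w)) fun p q => c • g p q :=
      hg.map (smulAddHom ℤ M c)
    convert this using 3 with p q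
    rw [← map_zsmul (YM u (p - l)) c, hd, map_zsmul]
  have h2 := h1.unique hl.deriv
  obtain ⟨k, hk⟩ := iterate_bounded A n u v
  have hk' := addMul_pow_eq_zero_of_lt (M := M) l (f := fun p q => YM (A.Y u p v) q w) (k := k)
    fun p hp q => by rw [h.eq_zero_of_mem_hPow (hk p hp)]; rfl
  refine ⟨k - 1, fun p hp q => eq_zero_of_intCast_smul hc ?_⟩
  rw [show c • g p q = _ from congrFun (congrFun h2 p) q]
  rw [hk' _ (by omega), hk' _ (by omega)]; simp

/-- The point is that `l` is independent of `r`: starting from `v` at `r = 0`, each further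
coefficient is a rescaled derivative. -/
theorem assocWith_creation (h : IsTruncatedModule A n YM) {l : ℕ} {u v : V} {w : M}
    (hl : AssocWith A.Y YM l u v w) (r : ℤ) : AssocWith A.Y YM l u (A.Y v r A.vac) w := by
  by_cases hr : r < 0
  · rw [A.Y_apply_vac_neg v r hr]
    have h0 : (addMul M ^ l) (fun p q => YM (A.Y u p 0) q w) = 0 := by
      convert map_zero (addMul M ^ l)
      simp
    unfold AssocWith
    rw [h0]
    convert IsShift.zero using 3
    simp
  · obtain ⟨m, rfl⟩ := Int.eq_ofNat_of_zero_le (not_lt.mp hr)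
    clear hr
    induction m with
    | zero => simpa [A.Y_apply_vac_zero v] using hl
    | succ m ih =>
      refine h.assocWith_of_deriv (c := m + 1) (by omega) (fun q => ?_) ih
      exact h.succ_smul_vac v w m q

end IsTruncatedModule

end Truncated


/-! ### Associativity for products of two and three fields. -/

section Words

variable {V M : Type*} [AddCommGroup V] [Module CH V] [AddCommGroup M] [Module CH M]

/-- `(x + z₁) ^ l (x + z₂) ^ l f(z₁, z₂, x)`. -/
noncomputable def addMul₂ (l : ℕ) (f : ℤ → ℤ → ℤ → M) : ℤ → ℤ → ℤ → M :=
  fun p r q => (addMul M ^ l) (fun p q => (addMul M ^ l) (f p) r q) p q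

/-- `(x + z₁) ^ l (x + z₂) ^ l (x + z₃) ^ l f(z₁, z₂, z₃, x)`. -/
noncomputable def addMul₃ (l : ℕ) (f : ℤ → ℤ → ℤ → ℤ → M) : ℤ → ℤ → ℤ → ℤ → M :=
  fun p r s q => (addMul M ^ l) (fun p q => addMul₂ l (f p) r s q) p q

theorem addMul₂_swap (l : ℕ) (f : ℤ → ℤ → ℤ → M) :
    addMul₂ l (fun p r q => f r p q) = fun p r q => addMul₂ l f r p q := by
  ext p r q
  exact addMul_pow_comm l (fun p r q => f r p q) p r q

theorem addMul₃_swap_right (l : ℕ) (f : ℤ → ℤ → ℤ → ℤ → M) :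
    addMul₃ l (fun p r s q => f p s r q) = fun p r s q => addMul₃ l f p s r q := by
  ext p r s q
  simp only [addMul₃, addMul₂_swap]

theorem addMul₃_swap_left (l : ℕ) (f : ℤ → ℤ → ℤ → ℤ → M) :
    addMul₃ l (fun p r s q => f r p s q) = fun p r s q => addMul₃ l f r p s q := by
  ext p r s q
  exact addMul_pow_comm l (fun p r q => (addMul M ^ l) (f r p) s q) p r q

theorem addMul_pow_sub (l : ℕ) (f g : ℤ → ℤ → M) (p q : ℤ) :
    (addMul M ^ l) (fun p q => f p q - g p q) p q =
      (addMul M ^ l) f p q - (addMul M ^ l) g p q := by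
  rw [← Pi.sub_apply, ← Pi.sub_apply, ← map_sub]
  rfl

theorem addMul_pow_add (l : ℕ) (f g : ℤ → ℤ → M) (p q : ℤ) :
    (addMul M ^ l) (fun p q => f p q + g p q) p q =
      (addMul M ^ l) f p q + (addMul M ^ l) g p q := by
  rw [← Pi.add_apply, ← Pi.add_apply, ← map_add]
  rfl

theorem addMul₂_sub (l : ℕ) (f g : ℤ → ℤ → ℤ → M) :
    addMul₂ l (f - g) = addMul₂ l f - addMul₂ l g := by
  ext p r q
  simp only [addMul₂, Pi.sub_apply]
  rw [← addMul_pow_sub]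
  simp only [map_sub, Pi.sub_apply]

theorem addMul₂_add (l : ℕ) (f g : ℤ → ℤ → ℤ → M) :
    addMul₂ l (f + g) = addMul₂ l f + addMul₂ l g := by
  ext p r q
  simp only [addMul₂, Pi.add_apply]
  rw [← addMul_pow_add]
  simp only [map_add, Pi.add_apply]

theorem addMul₃_sub (l : ℕ) (f g : ℤ → ℤ → ℤ → ℤ → M) :
    addMul₃ l (f - g) = addMul₃ l f - addMul₃ l g := by
  ext p r s q
  simp only [addMul₃, Pi.sub_apply]
  rw [← addMul_pow_sub]
  simp only [addMul₂_sub, Pi.sub_apply]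

theorem addMul₃_add (l : ℕ) (f g : ℤ → ℤ → ℤ → ℤ → M) :
    addMul₃ l (f + g) = addMul₃ l f + addMul₃ l g := by
  ext p r s q
  simp only [addMul₃, Pi.add_apply]
  rw [← addMul_pow_add]
  simp only [addMul₂_add, Pi.add_apply]

theorem mulLinear₂_addMul₂ (l : ℕ) (c : CH) (f : ℤ → ℤ → ℤ → M) :
    mulLinear₂ c (addMul₂ l f) = addMul₂ l (mulLinear₂ c f) := by
  ext p r q
  simp only [mulLinear₂, addMul₂, addMul_pow_apply, Finset.smul_sum, smul_add, smul_sub,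
    Finset.sum_add_distrib, Finset.sum_sub_distrib, smul_comm c, sub_right_comm _ (1 : ℤ)]

theorem IsShift.addMul₂_param (l : ℕ) {f g : ℤ → ℤ → ℤ → ℤ → M}
    (h : ∀ r s, IsShift (fun p q => f p r s q) fun p q => g p r s q) (r s : ℤ) :
    IsShift (fun p q => addMul₂ l (f p) r s q) fun p q => addMul₂ l (g p) r s q :=
  IsShift.addMul_pow_param l
    (fun r => IsShift.addMul_pow_param l (f := fun p => f p r) (g := fun p => g p r) (h r) s) r

theorem addMul₂_addMul_pow (l : ℕ) (f : ℤ → ℤ → ℤ → ℤ → M) (p r s q : ℤ) :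
    addMul₂ l (fun r s q => (addMul M ^ l) (fun p q => f p r s q) p q) r s q =
      addMul₃ l f p r s q := by
  unfold addMul₃ addMul₂
  rw [addMul_pow_comm l (fun p r q => (addMul M ^ l) (f p r) s q)]
  refine congrFun (congrFun (congrArg (addMul M ^ l) (funext fun r => funext fun q => ?_)) r) q
  exact (addMul_pow_comm l (fun p => f p r) p s q).symm

theorem IsShift₂.map (φ : Module.End CH M) {f g : ℤ → ℤ → ℤ → M} (h : IsShift₂ f g) :
    IsShift₂ (fun p r q => φ (f p r q)) fun p r q => φ (g p r q) := by
  obtain ⟨e, he, hg⟩ := h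
  exact ⟨fun p r q => φ (e p r q), fun p => (he p).map φ.toAddMonoidHom,
    fun r => (hg r).map φ.toAddMonoidHom⟩

namespace IsTruncatedModule

variable {A : NonlocalVertexAlgebra V} {n : ℕ} {YM : V →ₗ[CH] OpSeries M}

/-- Associativity is applied to `u₂, v` and then, coefficientwise in `z₂`, to `u₁`. Multiplication
by `(x + z₂) ^ l` mixes these coefficients, so they must share the exponent for `u₁`. -/
theorem isShift₂_word {l : ℕ} {u₁ u₂ v : V} {w : M} (h2 : AssocWith A.Y YM l u₂ v w)
    (h1 : ∀ r, AssocWith A.Y YM l u₁ (A.Y u₂ r v) w) :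
    IsShift₂ (fun p r q => YM u₁ (p - l) (YM u₂ (r - l) (YM v q w)))
      (addMul₂ l fun p r q => YM (A.Y u₁ p (A.Y u₂ r v)) q w) := by
  refine ⟨fun p r q => YM u₁ (p - l) ((addMul M ^ l) (fun p q => YM (A.Y u₂ p v) q w) r q),
    fun p => h2.map (YM u₁ (p - l)).toAddMonoidHom, fun r => ?_⟩
  have := IsShift.addMul_pow_param l h1 r
  unfold addMul₂
  convert this using 3
  · rw [addMul_pow_map]
  · rename_i p q
    exact addMul_pow_comm l (fun p r q => YM (A.Y u₁ p (A.Y u₂ r v)) q w) p r q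

theorem isShift₃_word {l : ℕ} {u₁ u₂ u₃ v : V} {w : M} (h3 : AssocWith A.Y YM l u₃ v w)
    (h2 : ∀ s, AssocWith A.Y YM l u₂ (A.Y u₃ s v) w)
    (h1 : ∀ r s, AssocWith A.Y YM l u₁ (A.Y u₂ r (A.Y u₃ s v)) w) :
    IsShift₃ (fun p r s q => YM u₁ (p - l) (YM u₂ (r - l) (YM u₃ (s - l) (YM v q w))))
      (addMul₃ l fun p r s q => YM (A.Y u₁ p (A.Y u₂ r (A.Y u₃ s v))) q w) := by
  refine ⟨fun p r s q => YM u₁ (p - l)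
    (addMul₂ l (fun r s q => YM (A.Y u₂ r (A.Y u₃ s v)) q w) r s q),
    fun p => (isShift₂_word h3 h2).map (YM u₁ (p - l)), fun r s => ?_⟩
  have := IsShift.addMul₂_param l h1 r s
  convert this using 3
  · simp only [addMul₂, addMul_pow_map]
  · rename_i p q
    exact (addMul₂_addMul_pow l (fun p r s q => YM (A.Y u₁ p (A.Y u₂ r (A.Y u₃ s v))) q w)
      p r s q).symm

theorem mulLinear₂_of_exchange {μ ν : CH} {u₁ u₂ : V}
    (hex : ExchangeRelation μ ν (YM u₁) (YM u₂)) (l : ℕ) (f : ℤ → M) :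
    mulLinear₂ μ (fun p r q => YM u₁ (p - l) (YM u₂ (r - l) (f q))) =
      mulLinear₂ ν (fun p r q => YM u₂ (r - l) (YM u₁ (p - l) (f q))) := by
  ext p r q
  have := LinearMap.congr_fun (congrFun (congrFun hex (p - l)) (r - l)) (f q)
  simp only [mulLinear, LinearMap.add_apply, LinearMap.sub_apply, LinearMap.smul_apply,
    Module.End.mul_apply] at this
  simp only [mulLinear₂, sub_right_comm _ (1 : ℤ), this]

/-- Division by `z₁ - z₂ + μ` for a nilpotent scalar `μ`. -/
theorem bounded_of_mulLinear₂ (h : IsTruncatedModule A n YM) {μ : CH} (hμ : hbar ∣ μ)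
    {f : ℤ → ℤ → ℤ → M} {k K : ℤ} (hK : ∀ p, ∀ r < K, ∀ q, f p r q = 0)
    (hf : ∀ p < k, ∀ r q, mulLinear₂ μ f p r q = 0) (r : ℤ) :
    ∃ k : ℤ, ∀ p < k, ∀ q, f p r q = 0 := by
  have key : ∀ m : ℕ, ∀ r < K + m, ∃ k : ℤ, ∀ p < k, ∀ q, f p r q = 0 := by
    intro m
    induction m with
    | zero => exact fun r hr => ⟨0, fun p _ => hK p r (by simpa using hr)⟩
    | succ m ih =>
      intro r hr
      obtain ⟨k', hk'⟩ := ih (r - 1) (by push_cast at hr; omega)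
      -- Once the `r - 1` term is gone, lowering `p` by one costs a factor `-μ`; after `n` steps
      -- this is divisible by `ħ ^ n`.
      have hstep : ∀ p < min k k', ∀ q, f (p - 1) r q = (-μ) • f p r q := by
        intro p hp q
        have h1 := hf p (lt_of_lt_of_le hp (min_le_left _ _)) r q
        rw [mulLinear₂, hk' p (lt_of_lt_of_le hp (min_le_right _ _)), sub_zero] at h1
        rw [eq_neg_of_add_eq_zero_left h1, neg_smul]
      have hiter : ∀ i : ℕ, ∀ p < min k k', ∀ q, f (p - i) r q = (-μ) ^ i • f p r q := by
        intro i
        induction i with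
        | zero => simp
        | succ i ih =>
          intro p hp q
          rw [pow_succ', mul_smul, ← ih p hp q, ← hstep (p - i) (by omega) q,
            show p - ((i + 1 : ℕ) : ℤ) = p - i - 1 by push_cast; ring]
      refine ⟨min k k' - n, fun p hp q => ?_⟩
      have h2 := hiter n (p + n) (by omega) q
      obtain ⟨c, hc⟩ : hbar ^ n ∣ (-μ) ^ n := pow_dvd_pow_of_dvd ((dvd_neg).mpr hμ) n
      rwa [add_sub_cancel_right, hc, mul_smul, h.hbar_pow_smul] at h2
  exact key (r - K + 1).toNat r (by omega)

/-- In the order `u₂ u₁` the pole in `z₁` after the shift is bounded uniformly in `z₂`. The exchange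
relation transfers this to the order `u₁ u₂` after multiplication by `(x + z₂) ^ l (z₁ - z₂ + μ)`.
Both factors can be removed at the cost of a bound depending on `r`, and this suffices for
`assocWith_of_bounded`. -/
theorem assocWith_of_exchange (h : IsTruncatedModule A n YM) {μ ν : CH} (hμ : hbar ∣ μ)
    {u₁ u₂ v : V} {w : M} {l : ℕ} (hex : ExchangeRelation μ ν (YM u₁) (YM u₂))
    (h1 : AssocWith A.Y YM l u₁ v w) (h2 : AssocWith A.Y YM l u₂ v w) (r : ℤ) :
    AssocWith A.Y YM l u₁ (A.Y u₂ r v) w := by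
  obtain ⟨B, hB⟩ := h.bounded v w
  have hFB : ∀ p r, ∀ q < B, YM u₁ (p - l) (YM u₂ (r - l) (YM v q w)) = 0 := fun p r q hq => by
    rw [hB q hq, map_zero, map_zero]
  -- the product in the order `u₁ u₂`
  have hex_c : ∀ r, ∃ g, IsShift (fun p q => YM u₁ (p - l) (YM (A.Y u₂ r v) q w)) g := fun r => by
    obtain ⟨b, hb⟩ := h.bounded (A.Y u₂ r v) w
    exact IsShift.exists_of_bounded (B := b) fun p q hq => by rw [hb q hq, map_zero]
  choose c hc using hex_c
  have hF : IsShift₂ (fun p r q => YM u₁ (p - l) (YM u₂ (r - l) (YM v q w)))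
      fun p r q => (addMul M ^ l) (fun r q => c r p q) r q := by
    refine ⟨fun p r q => YM u₁ (p - l) ((addMul M ^ l) (fun p q => YM (A.Y u₂ p v) q w) r q),
      fun p => h2.map (YM u₁ (p - l)).toAddMonoidHom, fun r => ?_⟩
    have := IsShift.addMul_pow_param l (g := fun p r q => c r p q) hc r
    convert this using 3
    rw [addMul_pow_map]
  -- the product in the order `u₂ u₁`
  set e : ℤ → ℤ → ℤ → M := fun r p q =>
    YM u₂ (r - l) ((addMul M ^ l) (fun p q => YM (A.Y u₁ p v) q w) p q) with he
  have he' : ∀ r, IsShift (fun p q => YM u₂ (r - l) (YM u₁ (p - l) (YM v q w))) (e r) :=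
    fun r => h1.map (YM u₂ (r - l)).toAddMonoidHom
  obtain ⟨d, hd⟩ := IsShift₂.exists_of_bounded (B := B)
    (f := fun r p q => YM u₂ (r - l) (YM u₁ (p - l) (YM v q w))) fun p r q hq => by
      rw [hB q hq, map_zero, map_zero]
  obtain ⟨k, hk⟩ := iterate_bounded A n u₁ v
  -- Substituting in `z₁` first produces `(x + z₁) ^ l Y(Y(u₁, z₁) v, x) w`, which starts at `z₁ ^
  -- k`; the later substitution in `z₂` does not involve `z₁`.
  have hd0 : ∀ p < k, ∀ r q, d r p q = 0 := by
    intro p hp r q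
    obtain ⟨e', hee, hde⟩ := hd
    obtain rfl : e = e' := funext fun r => (he' r).unique (hee r)
    have h0 : (fun r q => e r p q) = 0 := by
      ext r q
      simp only [he]
      rw [addMul_pow_eq_zero_of_lt l (fun p hp q => ?_) p hp q, map_zero]
      · rfl
      · rw [h.eq_zero_of_mem_hPow (hk p hp)]; rfl
    have := hde p
    rw [h0] at this
    exact congrFun (congrFun (this.unique IsShift.zero) r) q
  have hG := hd.swap (B := B) fun p r q hq => by rw [hB q hq, map_zero, map_zero]
  have hF' := hF.mulLinear₂ μ
  rw [mulLinear₂_of_exchange hex] at hF'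
  have hrel := hF'.unique (hG.mulLinear₂ ν)
  obtain ⟨K, hK⟩ := iterate_bounded A n u₂ v
  have hc0 : ∀ p, ∀ r < K, ∀ q, c r p q = 0 := by
    intro p r hr q
    have h0 := hc r
    rw [h.eq_zero_of_mem_hPow (hK r hr)] at h0
    have h0' : IsShift (0 : ℤ → ℤ → M) (c r) := by
      convert h0 using 1
      ext p q
      simp
    exact congrFun (congrFun (h0'.unique IsShift.zero) p) q
  refine h.assocWith_of_bounded (hc r)
    (h.bounded_of_mulLinear₂ (f := fun p r q => c r p q) (k := k) hμ hc0 (fun p hp r q => ?_) r)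
  -- Below `k` the `ν` side vanishes, and `(x + z₂) ^ l` commutes with `z₁ - z₂ + μ`.
  have h0 : (addMul M ^ l) (mulLinear₂ μ (fun p r q => c r p q) p) = 0 := by
    ext r q
    have h3 := congrFun (congrFun (congrFun hrel p) r) q
    simp only [mulLinear₂, hd0 _ hp, hd0 (p - 1) (by omega), sub_zero, smul_zero, add_zero] at h3
    rw [Pi.zero_apply, Pi.zero_apply, ← h3]
    simp only [mulLinear₂, addMul_pow_apply, Finset.smul_sum, smul_add, smul_sub,
      Finset.sum_add_distrib, Finset.sum_sub_distrib, smul_comm μ, sub_right_comm _ (1 : ℤ)]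
  exact congrFun (congrFun (eq_zero_of_addMul_pow_eq_zero l ⟨K, fun r hr q => by
    simp only [mulLinear₂, hc0 _ r hr, hc0 _ (r - 1) (by omega), sub_zero, smul_zero,
      add_zero]⟩ h0) r) q

end IsTruncatedModule

end Words


/-! ### The Serre relation as a symmetrized sum of two terms. -/

section Serre

variable {W : Type*} [AddCommGroup W] [Module CH W]

/-- The contribution of one permutation to the order-2 Serre relation. -/
noncomputable def serreTerm (a b : OpSeries W) (p r s : ℤ) : Module.End CH W :=
  a p * a r * b s - (a p * b s * a r + a p * b s * a r) + b s * a p * a r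

theorem serreRelation_iff {a b : OpSeries W} :
    SerreRelation a b ↔ ∀ p r s, serreTerm a b p r s + serreTerm a b r p s = 0 := by
  have huniv : (Finset.univ : Finset (Equiv.Perm (Fin 2))) = {1, Equiv.swap 0 1} := by decide
  have hne : (1 : Equiv.Perm (Fin 2)) ∉ ({Equiv.swap 0 1} : Finset (Equiv.Perm (Fin 2))) := by
    decide
  have key : ∀ (k : Fin 2 → ℤ) (j : ℤ), ∑ σ : Equiv.Perm (Fin 2),
      (a (k (σ 0)) * a (k (σ 1)) * b j - 2 * (a (k (σ 0)) * b j * a (k (σ 1)))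
        + b j * a (k (σ 0)) * a (k (σ 1))) =
      serreTerm a b (k 0) (k 1) j + serreTerm a b (k 1) (k 0) j := by
    intro k j
    rw [huniv, Finset.sum_insert hne, Finset.sum_singleton]
    simp only [Equiv.Perm.one_apply, Equiv.swap_apply_left, Equiv.swap_apply_right, serreTerm,
      two_mul]
  constructor
  · intro h p r s
    have := h ![p, r] s
    rw [key] at this
    simpa using this
  · intro h k j
    rw [key]
    exact h _ _ _

end Serre

/-! ### Recovering a series from its shift at `x = 0`. -/

section Shift

variable {M : Type*} [AddCommGroup M]

/-- Without negative powers of `x` one may set `x = 0`, where the shift is the identity. With `Y(1,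
x) = 1` this extracts the bare product of fields. -/
theorem IsShift₂.coeff_zero {f g : ℤ → ℤ → ℤ → M} (h : IsShift₂ f g)
    (hf : ∀ p r, ∀ q < 0, f p r q = 0) (p r : ℤ) : f p r 0 = g p r 0 := by
  rw [← h.sum_eq hf p r 0 (N := 1) (by simp)]
  simp

theorem IsShift₃.coeff_zero {f g : ℤ → ℤ → ℤ → ℤ → M} (h : IsShift₃ f g)
    (hf : ∀ p r s, ∀ q < 0, f p r s q = 0) (p r s : ℤ) : f p r s 0 = g p r s 0 := by
  obtain ⟨e, he, hg⟩ := h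
  rw [he p |>.coeff_zero (hf p), ← (hg r s).sum_eq (B := 0) (N := 1) _ p 0 (by simp)]
  · simp
  · intro p q hq
    rw [← (he p).sum_eq (B := 0) (hf p) r s (q := q) (N := 0) (by simpa using hq)]
    simp

end Shift

/-! ### Transfer of the relations between algebra and truncated module. -/

section Words

variable {V M : Type*} [AddCommGroup V] [Module CH V] [AddCommGroup M] [Module CH M]

theorem mulLinear₂_word (c : CH) (F : ℤ → ℤ → Module.End CH M) (l : ℕ) (f : ℤ → M) (p r q : ℤ) :
    mulLinear₂ c (fun p r q => F (p - l) (r - l) (f q)) p r q =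
      mulLinear c F (p - l) (r - l) (f q) := by
  simp only [mulLinear₂, mulLinear, sub_right_comm _ (1 : ℤ), LinearMap.add_apply,
    LinearMap.sub_apply, LinearMap.smul_apply]

theorem mulLinear₂_iterate (YM : V →ₗ[CH] OpSeries M) (c : CH) (F : ℤ → ℤ → Module.End CH V)
    (v : V) (w : M) (p r q : ℤ) :
    mulLinear₂ c (fun p r q => YM (F p r v) q w) p r q = YM (mulLinear c F p r v) q w := by
  simp only [mulLinear₂, mulLinear, LinearMap.add_apply,
    LinearMap.sub_apply, LinearMap.smul_apply, map_add, map_sub, map_smul, Pi.add_apply,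
    Pi.sub_apply, Pi.smul_apply]

/-- Laurent series modulo `ħ ^ n`. -/
def BoundedMod (n : ℕ) (φ : ℤ → V) : Prop := ∃ k : ℤ, ∀ p < k, φ p ∈ hPow V n

namespace BoundedMod

variable {n : ℕ} {φ ψ : ℤ → V}

theorem add (h : BoundedMod n φ) (h' : BoundedMod n ψ) : BoundedMod n fun p => φ p + ψ p := by
  obtain ⟨k, hk⟩ := h
  obtain ⟨k', hk'⟩ := h'
  exact ⟨min k k', fun p hp => add_mem (hk p (by omega)) (hk' p (by omega))⟩

theorem map (T : Module.End CH V) (h : BoundedMod n φ) : BoundedMod n fun p => T (φ p) := by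
  obtain ⟨k, hk⟩ := h
  refine ⟨k, fun p hp => ?_⟩
  obtain ⟨v, hv⟩ := mem_hPow.mp (hk p hp)
  exact mem_hPow.mpr ⟨T v, by rw [← map_smul, hv]⟩

theorem smul (c : CH) (h : BoundedMod n φ) : BoundedMod n fun p => c • φ p :=
  h.map (LinearMap.lsmul CH V c)

theorem sub (h : BoundedMod n φ) (h' : BoundedMod n ψ) : BoundedMod n fun p => φ p - ψ p := by
  obtain ⟨k, hk⟩ := h
  obtain ⟨k', hk'⟩ := h'
  exact ⟨min k k', fun p hp => sub_mem (hk p (by omega)) (hk' p (by omega))⟩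

theorem translate (h : BoundedMod n φ) : BoundedMod n fun p => φ (p - 1) := by
  obtain ⟨k, hk⟩ := h
  exact ⟨k, fun p hp => hk _ (by omega)⟩

theorem mulLinear_left (c : CH) {F : ℤ → ℤ → Module.End CH V} {v : V}
    (h : ∀ r, BoundedMod n fun p => F p r v) (r : ℤ) : BoundedMod n fun p => mulLinear c F p r v :=
  ((h r).translate.sub (h (r - 1))).add ((h r).smul c)

theorem mulLinear_right (c : CH) {F : ℤ → ℤ → Module.End CH V} {v : V}
    (h : ∀ p, BoundedMod n fun r => F p r v) (p : ℤ) : BoundedMod n fun r => mulLinear c F p r v :=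
  ((h (p - 1)).sub (h p).translate).add ((h p).smul c)

end BoundedMod

/-- Interchanging `z` and `w` changes the sign of `z - w`, hence of both constants. -/
theorem ExchangeRelation.symm_neg {μ ν : CH} {a b : OpSeries M} (h : ExchangeRelation μ ν a b) :
    ExchangeRelation (-ν) (-μ) b a := by
  ext i j w
  have := LinearMap.congr_fun (congrFun (congrFun h j) i) w
  simp only [mulLinear, LinearMap.add_apply, LinearMap.sub_apply, LinearMap.smul_apply,
    LinearMap.neg_apply, Module.End.mul_apply, neg_smul] at this ⊢
  rw [← sub_eq_zero] at this ⊢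
  rw [← this]
  abel

namespace IsTruncatedModule

variable {A : NonlocalVertexAlgebra V} {n : ℕ} {YM : V →ₗ[CH] OpSeries M}

theorem boundedMod (A : NonlocalVertexAlgebra V) (n : ℕ) (u v : V) :
    BoundedMod n fun p => A.Y u p v :=
  iterate_bounded A n u v

theorem exists_bound (h : IsTruncatedModule A n YM) {φ : ℤ → V} (hφ : BoundedMod n φ) (w : M) :
    ∃ k : ℤ, ∀ p < k, ∀ q, YM (φ p) q w = 0 := by
  obtain ⟨k, hk⟩ := hφ
  exact ⟨k, fun p hp q => by rw [h.eq_zero_of_mem_hPow (hk p hp)]; rfl⟩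

theorem vac_apply_of_ne (h : IsTruncatedModule A n YM) (w : M) {q : ℤ} (hq : q ≠ 0) :
    YM A.vac q w = 0 := by
  rw [h.vac, oneField, if_neg hq]; rfl

theorem vac_apply_zero (h : IsTruncatedModule A n YM) (w : M) : YM A.vac 0 w = w := by
  rw [h.vac, oneField, if_pos rfl]; rfl

/-- The series `(z₁ - z₂ + μ) u₁(z₁) u₂(z₂) - (z₁ - z₂ + ν) u₂(z₂) u₁(z₁)` on the module and on the
algebra are related by a shift. -/
theorem isShift₂_exchange (h : IsTruncatedModule A n YM) (μ ν : CH) {l : ℕ} {u₁ u₂ v : V} {w : M}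
    (h1 : AssocWith A.Y YM l u₁ v w) (h2 : AssocWith A.Y YM l u₂ v w)
    (h12 : ∀ r, AssocWith A.Y YM l u₁ (A.Y u₂ r v) w)
    (h21 : ∀ r, AssocWith A.Y YM l u₂ (A.Y u₁ r v) w) :
    IsShift₂ (fun p r q => (mulLinear μ (fun i j => YM u₁ i * YM u₂ j) (p - l) (r - l) -
        mulLinear ν (fun i j => YM u₂ j * YM u₁ i) (p - l) (r - l)) (YM v q w))
      (addMul₂ l fun p r q => YM ((mulLinear μ (fun i j => A.Y u₁ i * A.Y u₂ j) p r -
        mulLinear ν (fun i j => A.Y u₂ j * A.Y u₁ i) p r) v) q w) := by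
  obtain ⟨B, hB⟩ := h.bounded v w
  have hP := (isShift₂_word h2 h12).mulLinear₂ μ
  have hQ := ((isShift₂_word h1 h21).swap (B := B) fun p r q hq => by
    rw [hB q hq, map_zero, map_zero]).mulLinear₂ ν
  rw [← addMul₂_swap] at hQ
  rw [mulLinear₂_addMul₂] at hP hQ
  have := hP.sub hQ
  rw [← addMul₂_sub] at this
  convert this using 1
  · ext p r q
    rw [LinearMap.sub_apply, ← mulLinear₂_word μ _ l (fun q => YM v q w),
      ← mulLinear₂_word ν _ l (fun q => YM v q w)]
    rfl
  · congr 1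
    ext p r q
    rw [LinearMap.sub_apply, map_sub, Pi.sub_apply, LinearMap.sub_apply, ← mulLinear₂_iterate,
      ← mulLinear₂_iterate]
    rfl

theorem exists_assocWith (h : IsTruncatedModule A n YM) (s : Finset (V × V)) (w : M) :
    ∃ l, ∀ x ∈ s, AssocWith A.Y YM l x.1 x.2 w := by
  choose l hl using fun x : V × V => h.assoc x.1 x.2 w
  exact ⟨s.sup l, fun x hx => (hl x).mono (Finset.le_sup hx)⟩

theorem exchangeRelation_of_algebra (h : IsTruncatedModule A n YM) {μ ν : CH} {u₁ u₂ : V}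
    (hex : ExchangeRelation μ ν (A.Y u₁) (A.Y u₂)) : ExchangeRelation μ ν (YM u₁) (YM u₂) := by
  classical
  ext i j w
  -- The last two pairs feed `assocWith_creation`, which needs the exponent at `Y(uᵢ, z) 1` only
  -- through its constant term `uᵢ`.
  obtain ⟨l, hl⟩ := h.exists_assocWith {(u₁, A.vac), (u₂, A.vac), (u₁, u₂), (u₂, u₁)} w
  have h1 : AssocWith A.Y YM l u₁ A.vac w := hl (u₁, A.vac) (by simp)
  have h2 : AssocWith A.Y YM l u₂ A.vac w := hl (u₂, A.vac) (by simp)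
  have h12 : AssocWith A.Y YM l u₁ u₂ w := hl (u₁, u₂) (by simp)
  have h21 : AssocWith A.Y YM l u₂ u₁ w := hl (u₂, u₁) (by simp)
  have hs := h.isShift₂_exchange μ ν h1 h2 (h.assocWith_creation h12) (h.assocWith_creation h21)
  have h0 := hs.coeff_zero (fun p r q hq => by rw [h.vac_apply_of_ne w hq.ne, map_zero])
    (i + l) (j + l)
  rw [add_sub_cancel_right, add_sub_cancel_right, h.vac_apply_zero, LinearMap.sub_apply] at h0
  refine sub_eq_zero.mp (h0.trans ?_)
  unfold ExchangeRelation at hex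
  rw [hex]
  simp [addMul₂, addMul_pow_apply]

/-- The relation on the module makes the unshifted series zero, hence also its shift. The powers of
`x + z₁` and `x + z₂` cancel because the algebra side is bounded in each `zᵢ` modulo `ħ ^ n`. -/
theorem iterate_exchange_eq_zero (h : IsTruncatedModule A n YM) {μ ν : CH} (hμ : hbar ∣ μ)
    (hν : hbar ∣ ν) {u₁ u₂ : V} (hex : ExchangeRelation μ ν (YM u₁) (YM u₂)) (v : V) (i j : ℤ) :
    YM ((mulLinear μ (fun i j => A.Y u₁ i * A.Y u₂ j) i j -
      mulLinear ν (fun i j => A.Y u₂ j * A.Y u₁ i) i j) v) = 0 := by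
  classical
  ext q w
  obtain ⟨l, hl⟩ := h.exists_assocWith {(u₁, v), (u₂, v)} w
  have h1 : AssocWith A.Y YM l u₁ v w := hl (u₁, v) (by simp)
  have h2 : AssocWith A.Y YM l u₂ v w := hl (u₂, v) (by simp)
  have hs := h.isShift₂_exchange μ ν h1 h2 (h.assocWith_of_exchange hμ hex h1 h2)
    (h.assocWith_of_exchange ((dvd_neg).mpr hν) hex.symm_neg h2 h1)
  have h0 := hs.unique (g' := 0) (by
    unfold ExchangeRelation at hex
    simp only [hex, sub_self, LinearMap.zero_apply]
    exact ⟨0, fun _ => IsShift.zero, fun _ => IsShift.zero⟩)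
  have hb12 : ∀ r, BoundedMod n fun p => (A.Y u₁ p * A.Y u₂ r) v := fun r =>
    boundedMod A n u₁ (A.Y u₂ r v)
  have hb12' : ∀ p, BoundedMod n fun r => (A.Y u₁ p * A.Y u₂ r) v := fun p =>
    (boundedMod A n u₂ v).map (A.Y u₁ p)
  have hb21 : ∀ p, BoundedMod n fun r => (A.Y u₂ r * A.Y u₁ p) v := fun p =>
    boundedMod A n u₂ (A.Y u₁ p v)
  have hb21' : ∀ r, BoundedMod n fun p => (A.Y u₂ r * A.Y u₁ p) v := fun r =>
    (boundedMod A n u₁ v).map (A.Y u₂ r)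
  have hz := eq_zero_of_addMul_pow_eq_zero₂ l
    (fun r => h.exists_bound ((BoundedMod.mulLinear_left μ
      (F := fun i j => A.Y u₁ i * A.Y u₂ j) hb12 r).sub (BoundedMod.mulLinear_left ν
      (F := fun i j => A.Y u₂ j * A.Y u₁ i) hb21' r)) w)
    (fun p => h.exists_bound ((BoundedMod.mulLinear_right μ
      (F := fun i j => A.Y u₁ i * A.Y u₂ j) hb12' p).sub (BoundedMod.mulLinear_right ν
      (F := fun i j => A.Y u₂ j * A.Y u₁ i) hb21 p)) w)
    (fun p r q => congrFun (congrFun (congrFun h0 p) r) q)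
  exact congrFun (congrFun (congrFun hz i) j) q

theorem isShift₃_serre (h : IsTruncatedModule A n YM) {l : ℕ} {a b v : V} {w : M}
    (ha : AssocWith A.Y YM l a v w) (hb : AssocWith A.Y YM l b v w)
    (haa : ∀ v, AssocWith A.Y YM l a v w → ∀ r, AssocWith A.Y YM l a (A.Y a r v) w)
    (hab : ∀ v, AssocWith A.Y YM l a v w → AssocWith A.Y YM l b v w →
      ∀ r, AssocWith A.Y YM l a (A.Y b r v) w)
    (hba : ∀ v, AssocWith A.Y YM l a v w → AssocWith A.Y YM l b v w →
      ∀ r, AssocWith A.Y YM l b (A.Y a r v) w) :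
    IsShift₃ (fun p r s q => (serreTerm (YM a) (YM b) (p - l) (r - l) (s - l) +
        serreTerm (YM a) (YM b) (r - l) (p - l) (s - l)) (YM v q w))
      (addMul₃ l fun p r s q => YM ((serreTerm (A.Y a) (A.Y b) p r s +
        serreTerm (A.Y a) (A.Y b) r p s) v) q w) := by
  obtain ⟨B, hB⟩ := h.bounded v w
  have haab := isShift₃_word hb (hab v ha hb) fun r s => haa _ (hab v ha hb s) r
  -- Each word is shifted in its own order of factors; the swaps then realign the variables as `z₁,
  -- z₂` for `a` and the third for `b`.
  have haba := (isShift₃_word ha (hba v ha hb) fun r s =>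
    hab _ (haa v ha s) (hba v ha hb s) r).swap_right (B := B) fun p r s q hq => by
      simp only [hB q hq, map_zero]
  have hbaa := (isShift₃_word ha (haa v ha) fun r s =>
    hba _ (haa v ha s) (hba v ha hb s) r).swap_left (B := B) fun p r s q hq => by
      simp only [hB q hq, map_zero]
  rw [← addMul₃_swap_left] at hbaa
  replace hbaa := hbaa.swap_right (B := B) fun p r s q hq => by simp only [hB q hq, map_zero]
  rw [← addMul₃_swap_right] at haba hbaa
  have hterm := (haab.sub (haba.add haba)).add hbaa
  have hswap := hterm.swap_left (B := B) fun p r s q hq => by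
    simp only [Pi.add_apply, Pi.sub_apply, hB q hq, map_zero]; simp
  rw [← addMul₃_add, ← addMul₃_sub, ← addMul₃_add] at hterm hswap
  rw [← addMul₃_swap_left] at hswap
  have := hterm.add hswap
  rw [← addMul₃_add] at this
  convert this using 1
  · rfl
  · refine congrArg (addMul₃ l) ?_
    ext p r s q
    simp only [serreTerm, LinearMap.add_apply, LinearMap.sub_apply, Module.End.mul_apply, map_add,
      map_sub, Pi.add_apply, Pi.sub_apply]

/-- The exchange relations serve only to make one exponent valid for all inner vectors of the words
`aab`, `aba`, `baa`. Creation from the vacuum would not suffice, as it covers only vectors `Y(v, r)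
1`. -/
theorem isShift₃_serre_of_exchange (h : IsTruncatedModule A n YM) {μ ν μ' ν' : CH} (hμ : hbar ∣ μ)
    (hμ' : hbar ∣ μ') (hν' : hbar ∣ ν') {a b : V} (haa : ExchangeRelation μ ν (YM a) (YM a))
    (hab : ExchangeRelation μ' ν' (YM a) (YM b)) (v : V) (w : M) :
    ∃ l : ℕ, IsShift₃ (fun p r s q => (serreTerm (YM a) (YM b) (p - l) (r - l) (s - l) +
        serreTerm (YM a) (YM b) (r - l) (p - l) (s - l)) (YM v q w))
      (addMul₃ l fun p r s q => YM ((serreTerm (A.Y a) (A.Y b) p r s +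
        serreTerm (A.Y a) (A.Y b) r p s) v) q w) := by
  classical
  obtain ⟨l, hl⟩ := h.exists_assocWith {(a, v), (b, v)} w
  have hav : AssocWith A.Y YM l a v w := hl (a, v) (by simp)
  have hbv : AssocWith A.Y YM l b v w := hl (b, v) (by simp)
  exact ⟨l, h.isShift₃_serre hav hbv (fun v ha => h.assocWith_of_exchange hμ haa ha ha)
    (fun v ha hb => h.assocWith_of_exchange hμ' hab ha hb)
    (fun v ha hb => h.assocWith_of_exchange ((dvd_neg).mpr hν') hab.symm_neg hb ha)⟩

theorem serreRelation_of_algebra (h : IsTruncatedModule A n YM) {μ ν μ' ν' : CH} (hμ : hbar ∣ μ)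
    (hμ' : hbar ∣ μ') (hν' : hbar ∣ ν') {a b : V} (haa : ExchangeRelation μ ν (YM a) (YM a))
    (hab : ExchangeRelation μ' ν' (YM a) (YM b)) (hS : SerreRelation (A.Y a) (A.Y b)) :
    SerreRelation (YM a) (YM b) := by
  rw [serreRelation_iff] at hS ⊢
  intro p r s
  ext w
  obtain ⟨l, hl⟩ := h.isShift₃_serre_of_exchange hμ hμ' hν' haa hab A.vac w
  have h0 := hl.coeff_zero (fun p r s q hq => by rw [h.vac_apply_of_ne w hq.ne, map_zero])
    (p + l) (r + l) (s + l)
  rw [add_sub_cancel_right, add_sub_cancel_right, add_sub_cancel_right, h.vac_apply_zero] at h0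
  rw [h0]
  simp [hS, addMul₃, addMul₂, addMul_pow_apply]

theorem boundedMod_serreTerm (A : NonlocalVertexAlgebra V) (n : ℕ) (a b v : V) :
    (∀ r s, BoundedMod n fun p => serreTerm (A.Y a) (A.Y b) p r s v) ∧
    (∀ p s, BoundedMod n fun r => serreTerm (A.Y a) (A.Y b) p r s v) ∧
    (∀ p r, BoundedMod n fun s => serreTerm (A.Y a) (A.Y b) p r s v) := by
  have key : ∀ u₁ u₂ u₃ : V,
      (∀ j k, BoundedMod n fun i => (A.Y u₁ i * A.Y u₂ j * A.Y u₃ k) v) ∧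
      (∀ i k, BoundedMod n fun j => (A.Y u₁ i * A.Y u₂ j * A.Y u₃ k) v) ∧
      (∀ i j, BoundedMod n fun k => (A.Y u₁ i * A.Y u₂ j * A.Y u₃ k) v) := fun u₁ u₂ u₃ =>
    ⟨fun j k => boundedMod A n u₁ (A.Y u₂ j (A.Y u₃ k v)),
      fun i k => (boundedMod A n u₂ (A.Y u₃ k v)).map (A.Y u₁ i),
      fun i j => (boundedMod A n u₃ v).map (A.Y u₁ i * A.Y u₂ j)⟩
  obtain ⟨h1, h2, h3⟩ := key a a b
  obtain ⟨h4, h5, h6⟩ := key a b a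
  obtain ⟨h7, h8, h9⟩ := key b a a
  exact ⟨fun r s => ((h1 r s).sub ((h4 s r).add (h4 s r))).add (h8 s r),
    fun p s => ((h2 p s).sub ((h6 p s).add (h6 p s))).add (h9 s p),
    fun p r => ((h3 p r).sub ((h5 p r).add (h5 p r))).add (h7 p r)⟩

theorem iterate_serre_eq_zero (h : IsTruncatedModule A n YM) {μ ν μ' ν' : CH} (hμ : hbar ∣ μ)
    (hμ' : hbar ∣ μ') (hν' : hbar ∣ ν') {a b : V} (haa : ExchangeRelation μ ν (YM a) (YM a))
    (hab : ExchangeRelation μ' ν' (YM a) (YM b)) (hS : SerreRelation (YM a) (YM b)) (v : V)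
    (p r s : ℤ) :
    YM ((serreTerm (A.Y a) (A.Y b) p r s + serreTerm (A.Y a) (A.Y b) r p s) v) = 0 := by
  rw [serreRelation_iff] at hS
  ext q w
  obtain ⟨l, hl⟩ := h.isShift₃_serre_of_exchange hμ hμ' hν' haa hab v w
  simp only [hS, LinearMap.zero_apply] at hl
  have h0 := hl.unique IsShift₃.zero
  obtain ⟨h1, h2, h3⟩ := boundedMod_serreTerm A n a b v
  have hz := eq_zero_of_addMul_pow_eq_zero₃ l
    (fun r s => h.exists_bound ((h1 r s).add (h2 r s)) w)
    (fun p s => h.exists_bound ((h2 p s).add (h1 p s)) w)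
    (fun p r => h.exists_bound ((h3 p r).add (h3 r p)) w)
    (fun p r s q => congrFun (congrFun (congrFun (congrFun h0 p) r) s) q)
  exact congrFun (congrFun (congrFun (congrFun hz p) r) s) q

end IsTruncatedModule

end Words


/-! ### Passage to the quotients modulo `ħ ^ n` and back. -/

section Reduction

variable {V W : Type*} [AddCommGroup V] [Module CH V] [AddCommGroup W] [Module CH W]

/-- Both `w` and `0` are limits of the zero series, and limits are unique. -/
theorem eq_zero_of_forall_mem_hPow (hW : IsTopologicallyFree W) {w : W} (h : ∀ n, w ∈ hPow W n) :
    w = 0 := by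
  obtain ⟨W₀, -, hlim, -⟩ := hW
  refine (hlim (fun _ => 0) fun _ => W₀.zero_mem).unique (fun n => ?_) (fun n => ?_)
  · simpa using h n
  · simp

theorem map_hPow_le (T : Module.End CH W) (n : ℕ) : hPow W n ≤ (hPow W n).comap T := by
  intro w hw
  obtain ⟨w', rfl⟩ := mem_hPow.mp hw
  exact mem_hPow.mpr ⟨T w', by rw [map_smul]⟩

/-- The reduction modulo `ħ ^ n` of a vertex operator map. -/
noncomputable def reduce (n : ℕ) (YW : V →ₗ[CH] OpSeries W) : V →ₗ[CH] OpSeries (W ⧸ hPow W n) where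
  toFun v p := (hPow W n).mapQ (hPow W n) (YW v p) (map_hPow_le _ n)
  map_add' u v := by
    ext p w
    simp
  map_smul' c v := by
    ext p w
    simp

theorem reduce_apply (n : ℕ) (YW : V →ₗ[CH] OpSeries W) (v : V) (p : ℤ) (w : W) :
    reduce n YW v p ((hPow W n).mkQ w) = (hPow W n).mkQ (YW v p w) := rfl

/-- In the quotient, `ħ`-adic convergence to zero becomes eventual vanishing, and the congruence of
late partial sums becomes an exact shift. -/
theorem isTruncatedModule_reduce {A : NonlocalVertexAlgebra V} (M : VModule A W) (n : ℕ)
    (hn : 0 < n) : IsTruncatedModule A n (reduce n M.YW) where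
  hbar_pow_smul w := by
    obtain ⟨w, rfl⟩ := (hPow W n).mkQ_surjective w
    rw [← map_smul, Submodule.mkQ_apply, Submodule.Quotient.mk_eq_zero]
    exact mem_hPow.mpr ⟨w, rfl⟩
  bounded u w := by
    obtain ⟨w, rfl⟩ := (hPow W n).mkQ_surjective w
    obtain ⟨k, hk⟩ := M.isHField u w n
    refine ⟨1 - k, fun p hp => ?_⟩
    have := hk (-p).toNat (by omega)
    rw [Int.toNat_of_nonneg (by omega), neg_neg] at this
    rwa [reduce_apply, Submodule.mkQ_apply, Submodule.Quotient.mk_eq_zero]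
  vac := by
    funext p
    refine LinearMap.ext fun w => ?_
    obtain ⟨w, rfl⟩ := (hPow W n).mkQ_surjective w
    rw [reduce_apply, M.YW_vac]
    simp only [oneField]
    split_ifs <;> simp
  assoc u v w := by
    obtain ⟨w, rfl⟩ := (hPow W n).mkQ_surjective w
    obtain ⟨l, hl⟩ := M.weakAssoc u v w n hn
    refine ⟨l, fun p q => ?_⟩
    obtain ⟨J, hJ⟩ := hl p q
    refine ⟨J, fun N hN => ?_⟩
    have := (Submodule.Quotient.eq (hPow W n)).mpr (hJ N hN)
    rw [← Submodule.mkQ_apply, ← Submodule.mkQ_apply, assocIterateCoeff, map_sum, map_sum] at this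
    simp only [assocProductTerm, map_zsmul, map_nsmul, ← reduce_apply] at this
    rw [addMul_pow_apply]
    exact this

theorem eq_of_forall_mkQ_eq (hW : IsTopologicallyFree W) {S T : Module.End CH W}
    (h : ∀ n, 0 < n → ∀ w, (hPow W n).mkQ (S w) = (hPow W n).mkQ (T w)) : S = T := by
  ext w
  refine sub_eq_zero.mp (eq_zero_of_forall_mem_hPow hW fun n => ?_)
  rcases Nat.eq_zero_or_pos n with rfl | hn
  · exact mem_hPow.mpr ⟨S w - T w, by simp⟩
  · exact (Submodule.Quotient.eq _).mp (h n hn w)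

theorem mulLinear_reduce (n : ℕ) (YW : V →ₗ[CH] OpSeries W) (c : CH) (u v : V) (i j : ℤ) (w : W) :
    mulLinear c (fun i j => reduce n YW u i * reduce n YW v j) i j ((hPow W n).mkQ w) =
      (hPow W n).mkQ (mulLinear c (fun i j => YW u i * YW v j) i j w) := by
  simp only [mulLinear, LinearMap.add_apply, LinearMap.sub_apply, LinearMap.smul_apply,
    Module.End.mul_apply, reduce_apply, map_add, map_sub, map_smul]

theorem mulLinear_reduce_swap (n : ℕ) (YW : V →ₗ[CH] OpSeries W) (c : CH) (u v : V) (i j : ℤ)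
    (w : W) :
    mulLinear c (fun i j => reduce n YW v j * reduce n YW u i) i j ((hPow W n).mkQ w) =
      (hPow W n).mkQ (mulLinear c (fun i j => YW v j * YW u i) i j w) := by
  simp only [mulLinear, LinearMap.add_apply, LinearMap.sub_apply, LinearMap.smul_apply,
    Module.End.mul_apply, reduce_apply, map_add, map_sub, map_smul]

theorem exchangeRelation_iff_reduce (hW : IsTopologicallyFree W) (YW : V →ₗ[CH] OpSeries W)
    (μ ν : CH) (u v : V) : ExchangeRelation μ ν (YW u) (YW v) ↔
      ∀ n, 0 < n → ExchangeRelation μ ν (reduce n YW u) (reduce n YW v) := by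
  constructor
  · intro h n _
    funext i j
    refine LinearMap.ext fun w => ?_
    obtain ⟨w, rfl⟩ := (hPow W n).mkQ_surjective w
    rw [mulLinear_reduce, mulLinear_reduce_swap, show mulLinear μ _ = _ from h]
  · intro h
    funext i j
    refine eq_of_forall_mkQ_eq hW fun n hn w => ?_
    rw [← mulLinear_reduce, ← mulLinear_reduce_swap, show mulLinear μ _ = _ from h n hn]

theorem serreTerm_reduce (n : ℕ) (YW : V →ₗ[CH] OpSeries W) (a b : V) (p r s : ℤ) (w : W) :
    serreTerm (reduce n YW a) (reduce n YW b) p r s ((hPow W n).mkQ w) =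
      (hPow W n).mkQ (serreTerm (YW a) (YW b) p r s w) := by
  simp only [serreTerm, LinearMap.add_apply, LinearMap.sub_apply, Module.End.mul_apply,
    reduce_apply, map_add, map_sub]

theorem serreRelation_iff_reduce (hW : IsTopologicallyFree W) (YW : V →ₗ[CH] OpSeries W)
    (a b : V) : SerreRelation (YW a) (YW b) ↔
      ∀ n, 0 < n → SerreRelation (reduce n YW a) (reduce n YW b) := by
  simp only [serreRelation_iff]
  constructor
  · intro h n _ p r s
    refine LinearMap.ext fun w => ?_
    obtain ⟨w, rfl⟩ := (hPow W n).mkQ_surjective w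
    rw [LinearMap.add_apply, serreTerm_reduce, serreTerm_reduce, ← map_add, ← LinearMap.add_apply, h]
    simp
  · intro h p r s
    refine eq_of_forall_mkQ_eq hW fun n hn w => ?_
    rw [LinearMap.add_apply, map_add, ← serreTerm_reduce, ← serreTerm_reduce, ← LinearMap.add_apply,
      h n hn]
    simp

theorem VModule.Faithful.eq_zero {A : NonlocalVertexAlgebra V} {M : VModule A W} (hM : M.Faithful)
    {v : V} (h : ∀ n, 0 < n → reduce n M.YW v = 0) : v = 0 := by
  refine hM ?_
  rw [map_zero]
  funext p
  refine eq_of_forall_mkQ_eq M.topFree fun n hn w => ?_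
  rw [← reduce_apply, h n hn]
  simp

end Reduction

end HAdic

theorem proposition4p10 {V : Type*} [AddCommGroup V] [Module HAdic.CH V]
    (A : HAdic.NonlocalVertexAlgebra V) (a b : V)
    {W : Type*} [AddCommGroup W] [Module HAdic.CH W] (M : HAdic.VModule A W) :
    ((HAdic.ExchangeRelation (-(2 * HAdic.hbar)) (2 * HAdic.hbar) (A.Y a) (A.Y a) ∧
        HAdic.ExchangeRelation HAdic.hbar (-HAdic.hbar) (A.Y a) (A.Y b) ∧
        HAdic.SerreRelation (A.Y a) (A.Y b)) →
      (HAdic.ExchangeRelation (-(2 * HAdic.hbar)) (2 * HAdic.hbar) (M.YW a) (M.YW a) ∧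
        HAdic.ExchangeRelation HAdic.hbar (-HAdic.hbar) (M.YW a) (M.YW b) ∧
        HAdic.SerreRelation (M.YW a) (M.YW b))) ∧
    (M.Faithful →
      (HAdic.ExchangeRelation (-(2 * HAdic.hbar)) (2 * HAdic.hbar) (M.YW a) (M.YW a) ∧
        HAdic.ExchangeRelation HAdic.hbar (-HAdic.hbar) (M.YW a) (M.YW b) ∧
        HAdic.SerreRelation (M.YW a) (M.YW b)) →
      (HAdic.ExchangeRelation (-(2 * HAdic.hbar)) (2 * HAdic.hbar) (A.Y a) (A.Y a) ∧
        HAdic.ExchangeRelation HAdic.hbar (-HAdic.hbar) (A.Y a) (A.Y b) ∧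
        HAdic.SerreRelation (A.Y a) (A.Y b))) := by
  have hn2 : HAdic.hbar ∣ -(2 * HAdic.hbar) := (dvd_mul_left _ _).neg_right
  have h2 : HAdic.hbar ∣ 2 * HAdic.hbar := dvd_mul_left _ _
  have h1 : HAdic.hbar ∣ HAdic.hbar := dvd_rfl
  have hn1 : HAdic.hbar ∣ -HAdic.hbar := dvd_rfl.neg_right
  refine ⟨fun ⟨haa, hab, hS⟩ => ?_, fun hM ⟨haa, hab, hS⟩ => ?_⟩
  · have hT := fun n hn => HAdic.isTruncatedModule_reduce M n hn
    refine ⟨(HAdic.exchangeRelation_iff_reduce M.topFree _ _ _ _ _).mpr fun n hn =>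
      (hT n hn).exchangeRelation_of_algebra haa,
      (HAdic.exchangeRelation_iff_reduce M.topFree _ _ _ _ _).mpr fun n hn =>
      (hT n hn).exchangeRelation_of_algebra hab,
      (HAdic.serreRelation_iff_reduce M.topFree _ _ _).mpr fun n hn =>
      -- The Serre relation is transferred with the help of the exchange relations already obtained
      -- on the module.
      (hT n hn).serreRelation_of_algebra hn2 h1 hn1 ((hT n hn).exchangeRelation_of_algebra haa)
        ((hT n hn).exchangeRelation_of_algebra hab) hS⟩
  · rw [HAdic.exchangeRelation_iff_reduce M.topFree] at haa hab
    rw [HAdic.serreRelation_iff_reduce M.topFree] at hS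
    have hT := fun n hn => HAdic.isTruncatedModule_reduce M n hn
    refine ⟨?_, ?_, HAdic.serreRelation_iff.mpr fun p r s => LinearMap.ext fun v => ?_⟩
    · refine funext fun i => funext fun j => LinearMap.ext fun v => ?_
      exact sub_eq_zero.mp (hM.eq_zero fun n hn =>
        (hT n hn).iterate_exchange_eq_zero hn2 h2 (haa n hn) v i j)
    · refine funext fun i => funext fun j => LinearMap.ext fun v => ?_
      exact sub_eq_zero.mp (hM.eq_zero fun n hn =>
        (hT n hn).iterate_exchange_eq_zero h1 hn1 (hab n hn) v i j)
    · exact hM.eq_zero fun n hn => (hT n hn).iterate_serre_eq_zero hn2 h1 hn1 (haa n hn)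
        (hab n hn) (hS n hn) v p r s
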